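/- **Setting.** Let $\mathcal G=(\mathcal V,\mathcal E)$ be a finite connected graph (sensors and their range measurements). For every sensor $i$ let $\mathcal N_i$ be its set of neighbours and $\mathcal N_{i,a}$ a finite set of anchors with known positions $a_k\in\mathbb R^D$. For $\{i,j\}\in\mathcal E$ let $d\mapsto p_{i,j}(d\,|\,r_{i,j})$, and for $k\in\mathcal N_{i,a}$ let $e\mapsto p_{i,k,a}(e\,|\,v_{i,k})$, be nonnegative log-concave functions on $[0,\infty)$ (the sensing densities at the observed measurements). Put $z_{i,j}=(Y_{ii},Y_{jj},Y_{ij},\delta_{i,j},d_{i,j},x_i,x_j)\in\mathbb R^{5+2D}$ for each edge, with $z_{j,i}=z_{i,j}$ up to exchanging the roles of the endpoints, and $p_i=(\epsilon_i,e_i,Y_{ii},x_i)$ for each sensor. Let $\mathcal Z_{i,j}$ be the set of $z_{i,j}$ with $$Y_{ii}+Y_{jj}-2Y_{ij}=\delta_{i,j}\ge 0,\quad d_{i,j}\ge 0,\quad \begin{pmatrix}1&d_{i,j}\\ d_{i,j}&\delta_{i,j}\end{pmatrix}\succeq0,\quad \begin{pmatrix} I_D&x_i&x_j\\ x_i^{T}&Y_{ii}&Y_{ij}\\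 x_j^{T}&Y_{ij}&Y_{jj}\end{pmatrix}\succeq0,$$ and $\mathcal P_i$ the set of $p_i$ with, for all $k\in\mathcal N_{i,a}$, $$Y_{ii}-2x_i^{T}a_k+\|a_k\|^2=\epsilon_{i,k}\ge 0,\quad e_{i,k}\ge 0,\quad \begin{pmatrix}1&e_{i,k}\\ e_{i,k}&\epsilon_{i,k}\end{pmatrix}\succeq0 .$$ Each sensor $i$ holds copies $y^i_{i,j}$ of $z_{i,j}$ for $j\in\mathcal N_i$, collected in $y^i_i$, and the vector $p_i$; the entries $Y_{ii},x_i$ are the same in all vectors held by $i$. Write $-\sum_{\{i,j\}\in\mathcal E}\ln p_{i,j}(d_{i,j}|r_{i,j})-\sum_i\sum_{k\in\mathcal N_{i,a}}\ln p_{i,k,a}(e_{i,k}|v_{i,k})$ as $\sum_i f_i(y_i^i,p_i)$, where the $-\ln p_{i,j}$ term is divided between $f_i$ and $f_j$ with fixed nonnegative weights of sum $1$, and the anchor terms of sensor $i$ belong to $f_i$ ($-\ln 0=+\infty$). The problem is to minimize $\sum_i f_i(y_i^i,p_i)$ over $q=(y,p,z)$ subject to $y^i_{i,j},y^j_{i,j}\in\mathcal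 Z_{i,j}$, $p_i\in\mathcal P_i$ and $y^i_{i,j}=z_{i,j}=y^j_{i,j}$. For $\rho>0$ let $$\mathcal L(q,\lambda)=\sum_i f_i(y_i^i,p_i)+\sum_{i}\sum_{j\in\mathcal N_i}\Big[\lambda_{i,j}^{i\,T}(y^i_{i,j}-z_{i,j})+\tfrac{\rho}{2}\|y^i_{i,j}-z_{i,j}\|_2^2\Big].$$ **Algorithm (distributed ADMM).** Start with $q^{(0)}=0$, $\lambda^{(0)}=0$, and for $t\ge0$ let $$(y_i^{i(t+1)},p_i^{(t+1)})\in\arg\min_{y^i_{i,j}\in\mathcal Z_{i,j},\,p_i\in\mathcal P_i}\Big\{f_i(y_i^i,p_i)+\sum_{j\in\mathcal N_i}\big[\lambda_{i,j}^{i(t)\,T}y_{i,j}^i+\tfrac\rho2\|y_{i,j}^i-z_{i,j}^{(t)}\|_2^2\big]\Big\},$$ $$z_{i,j}^{(t+1)}=\tfrac12\big(y_{i,j}^{i(t+1)}+y_{i,j}^{j(t+1)}\big),\qquad \lambda_{i,j}^{i(t+1)}=\lambda_{i,j}^{i(t)}+\rho\big(y_{i,j}^{i(t+1)}-z_{i,j}^{(t+1)}\big).$$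 **Theorem.** Let $q^{(t)},\lambda^{(t)}$ be generated by this algorithm. Assume that the problem has a primal-dual solution $(q^*,\lambda^*)$: $q^*$ is optimal with finite cost, and $\lambda^*$ is a Lagrange multiplier for the constraints $y^i_{i,j}=z_{i,j}$, i.e. $q^*$ minimizes the ordinary Lagrangian (that is, $\mathcal L$ without the quadratic terms) at $\lambda^*$ over all $q$ with $y^i_{i,j}\in\mathcal Z_{i,j}$, $p_i\in\mathcal P_i$. Let $$C_0=\tfrac12\big(2\rho\|z^{(0)}-z^*\|_2^2+\rho^{-1}\|\lambda^{(0)}-\lambda^*\|_2^2\big),$$ where $\|z\|_2^2$ is the sum over the undirected edges. (a) The averages $\bar q_t=\frac1{t+1}\sum_{\kappa=0}^{t}q^{(\kappa+1)}$ of the computed iterates satisfy the set constraints, have finite cost, and for all $t\ge0$ $$0\le\mathcal L(\bar q_t,\lambda^*)-\mathcal L(q^*,\lambda^*)\le\frac{C_0}{t+1}.$$ (a') If all the sensing densities are positive at distance $0$ (so that $q^{(0)}=0$ has finite cost), then the averages $\frac1{t+1}\sum_{\kappa=0}^{t}q^{(\kappa)}$, which include the initial guess, satisfy the same inequalities with $C_0+\mathcal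 L(q^{(0)},\lambda^*)-\mathcal L(q^*,\lambda^*)$ in place of $C_0$. (b) If the sensing densities are upper semicontinuous on $[0,\infty)$, there is an optimal solution $q^{o}=(y^o,p^o,z^o)$ of the problem such that $y^{(t)}\to y^o$ and $z^{(t)}\to z^o$; moreover, the distance of $q^{(t)}$ to the set of optimal solutions tends to $0$. If, in addition, the minimizers in the node updates of the run are unique, then $\|q^{(t)}-q^{o}\|\to0$. -/

import Mathlib

open Filter Topology

noncomputable section

namespace SensorNet

/-- `f` is log-concave on the set `s` of reals (values `0` are allowed, i.e. `-log f` may be `+∞`). -/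
def LogConcaveOn (s : Set ℝ) (f : ℝ → ℝ) : Prop :=
  (∀ x ∈ s, 0 ≤ f x) ∧
  ∀ x ∈ s, ∀ y ∈ s, ∀ a b : ℝ, 0 ≤ a → 0 ≤ b → a + b = 1 →
    f x ^ a * f y ^ b ≤ f (a * x + b * y)

/-- Vectors `(Y_ii, Y_jj, Y_ij, δ_ij, d_ij, x_i, x_j)` in `ℝ^(5+2D)`, with the Euclidean norm.
The first endpoint `i` is the "own" node and the second endpoint `j` is the "other" node. -/
abbrev EdgeVec (D : ℕ) := EuclideanSpace ℝ (Fin 5 ⊕ (Fin D ⊕ Fin D))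

namespace EdgeVec

variable {D : ℕ}

/-- `Y_ii` -/
def Yown (v : EdgeVec D) : ℝ := v (Sum.inl 0)
/-- `Y_jj` -/
def Yother (v : EdgeVec D) : ℝ := v (Sum.inl 1)
/-- `Y_ij` -/
def Ycross (v : EdgeVec D) : ℝ := v (Sum.inl 2)
/-- `δ_ij` (squared distance variable) -/
def delta (v : EdgeVec D) : ℝ := v (Sum.inl 3)
/-- `d_ij` (distance variable) -/
def d (v : EdgeVec D) : ℝ := v (Sum.inl 4)
/-- `x_i` -/
def xown (v : EdgeVec D) (r : Fin D) : ℝ := v (Sum.inr (Sum.inl r))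
/-- `x_j` -/
def xother (v : EdgeVec D) (r : Fin D) : ℝ := v (Sum.inr (Sum.inr r))

/-- The permutation of coordinates that exchanges the roles of the two endpoints. -/
def flipIdx : Fin 5 ⊕ (Fin D ⊕ Fin D) → Fin 5 ⊕ (Fin D ⊕ Fin D)
  | Sum.inl c => Sum.inl (Equiv.swap 0 1 c)
  | Sum.inr c => Sum.inr c.swap

/-- The same edge vector, read from the other endpoint:
`(Y_ii, Y_jj, Y_ij, δ, d, x_i, x_j) ↦ (Y_jj, Y_ii, Y_ij, δ, d, x_j, x_i)`. -/
def flip (v : EdgeVec D) : EdgeVec D := WithLp.toLp 2 (fun c => v (flipIdx c))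

/-- The convex set `𝒵_ij`: `Y_ii + Y_jj - 2 Y_ij = δ`, `δ ≥ 0`, `d ≥ 0`,
`[1, d; d, δ] ⪰ 0` and `[I_D, x_i, x_j; x_iᵀ, Y_ii, Y_ij; x_jᵀ, Y_ij, Y_jj] ⪰ 0`. -/
def MemZ (v : EdgeVec D) : Prop :=
  Yown v + Yother v - 2 * Ycross v = delta v ∧ 0 ≤ delta v ∧
  (!![1, d v; d v, delta v] : Matrix (Fin 2) (Fin 2) ℝ).PosSemidef ∧ 0 ≤ d v ∧
  (Matrix.fromBlocks (1 : Matrix (Fin D) (Fin D) ℝ)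
    (Matrix.of fun r => ![xown v r, xother v r])
    (Matrix.of fun r => ![xown v r, xother v r]).transpose
    !![Yown v, Ycross v; Ycross v, Yother v]).PosSemidef

end EdgeVec

/-- The data of a localization problem: the graph of the inter-sensor measurements, the anchors
seen by each sensor, the anchor positions, and the sensing densities at the observed measurements,
as functions of the unknown distance. -/
structure Network (V A : Type*) (D : ℕ) where
  /-- the measurement graph `𝒢 = (𝒱, ℰ)` -/
  G : SimpleGraph V
  /-- `𝒩_{i,a}` -/
  anchorNbrs : V → Finset A
  /-- the anchor positions `a_k` -/
  anchorPos : A → EuclideanSpace ℝ (Fin D)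
  /-- `pEdge s(i, j) d = p_{i,j}(d | r_{i,j})` -/
  pEdge : Sym2 V → ℝ → ℝ
  /-- `pAnchor i k e = p_{i,k,a}(e | v_{i,k})` -/
  pAnchor : V → A → ℝ → ℝ
  /-- `share (i, j)` is the fraction of the edge cost `-ln p_{i,j}` that is put into `f_i` -/
  share : G.Dart → ℝ

namespace Network

variable {V A : Type*} {D : ℕ} [Fintype V] (N : Network V A D)

open Classical in
instance : Fintype N.G.Dart := inferInstance

/-- The sensing densities are log-concave functions of the distance. -/
def LogConcaveSensing : Prop :=
  (∀ e ∈ N.G.edgeSet, LogConcaveOn (Set.Ici 0) (N.pEdge e)) ∧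
  ∀ i, ∀ k ∈ N.anchorNbrs i, LogConcaveOn (Set.Ici 0) (N.pAnchor i k)

/-- The sensing densities are upper semicontinuous in the distance, i.e. the costs are closed. -/
def UscSensing : Prop :=
  (∀ e ∈ N.G.edgeSet, UpperSemicontinuousOn (N.pEdge e) (Set.Ici 0)) ∧
  ∀ i, ∀ k ∈ N.anchorNbrs i, UpperSemicontinuousOn (N.pAnchor i k) (Set.Ici 0)

/-- The costs of the edge `{i, j}` in `f_i` and in `f_j` add up to `-ln p_{i,j}`. -/
def IsSplit : Prop :=
  ∀ a : N.G.Dart, 0 ≤ N.share a ∧ N.share a + N.share a.symm = 1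

/-- Local vectors `p_i = (ε_i, e_i, Y_ii, x_i)` with the Euclidean norm. -/
abbrev LocalVec (i : V) :=
  EuclideanSpace ℝ (({k // k ∈ N.anchorNbrs i} ⊕ {k // k ∈ N.anchorNbrs i}) ⊕ (Unit ⊕ Fin D))

variable {N} in
/-- `ε_{i,k}` -/
def eps {i : V} (p : N.LocalVec i) (k : {k // k ∈ N.anchorNbrs i}) : ℝ := p (Sum.inl (Sum.inl k))
variable {N} in
/-- `e_{i,k}` -/
def e {i : V} (p : N.LocalVec i) (k : {k // k ∈ N.anchorNbrs i}) : ℝ := p (Sum.inl (Sum.inr k))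
variable {N} in
/-- `Y_ii` -/
def locY {i : V} (p : N.LocalVec i) : ℝ := p (Sum.inr (Sum.inl ()))
variable {N} in
/-- `x_i` -/
def locX {i : V} (p : N.LocalVec i) (r : Fin D) : ℝ := p (Sum.inr (Sum.inr r))

/-- The convex set `𝒫_i`: for every neighbouring anchor `k`,
`Y_ii - 2 x_iᵀ a_k + ‖a_k‖² = ε_{i,k}`, `ε_{i,k} ≥ 0`, `[1, e; e, ε] ⪰ 0`, `e_{i,k} ≥ 0`. -/
def MemP (i : V) (p : N.LocalVec i) : Prop :=
  ∀ k : {k // k ∈ N.anchorNbrs i},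
    locY p - 2 * (∑ r, locX p r * N.anchorPos k r) + ‖N.anchorPos k‖ ^ 2 = eps p k ∧
    0 ≤ eps p k ∧
    (!![1, e p k; e p k, eps p k] : Matrix (Fin 2) (Fin 2) ℝ).PosSemidef ∧ 0 ≤ e p k

/-- One `ℝ^(5+2D)` vector for each ordered pair of adjacent sensors. -/
abbrev EdgeFam := N.G.Dart → EdgeVec D

/-- The stacked local vectors. -/
abbrev LocalFam := (i : V) → N.LocalVec i

/-- The stacked variable `q = (y, p, z)`. For a dart `a = (i, j)`, `y a` is the copy of the edge
vector of `{i, j}` held by `i`, and `y a.symm` is the one held by `j`, listed from `j`'s side. -/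
abbrev Var := N.EdgeFam × N.LocalFam × N.EdgeFam

open Classical in
/-- The local cost `f_i(y_i, p_i)`, meaningful where the densities that occur are positive
(it is `+∞` elsewhere; see `NodeAdm`). -/
def nodeCost (i : V) (y : N.EdgeFam) (p : N.LocalVec i) : ℝ :=
  -((∑ a : N.G.Dart with a.fst = i, N.share a * Real.log (N.pEdge a.edge (y a).d)) +
    ∑ k : {k // k ∈ N.anchorNbrs i}, Real.log (N.pAnchor i k (e p k)))

/-- `(y_i, p_i)` is admissible for node `i`: `y_{i,j} ∈ 𝒵_ij` for all neighbours `j`, `p_i ∈ 𝒫_i`,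
the variables `Y_ii`, `x_i` of node `i` are the same in all of these vectors, and the local
cost `f_i` is finite. Only the components `y a` with `a.fst = i` are involved. -/
def NodeAdm (i : V) (y : N.EdgeFam) (p : N.LocalVec i) : Prop :=
  (∀ a : N.G.Dart, a.fst = i →
    (y a).MemZ ∧ (y a).Yown = locY p ∧ (∀ r, (y a).xown r = locX p r) ∧
    (N.share a ≠ 0 → 0 < N.pEdge a.edge (y a).d)) ∧
  N.MemP i p ∧
  ∀ k : {k // k ∈ N.anchorNbrs i}, 0 < N.pAnchor i k (e p k)

/-- `(y, p)` is admissible for every node. -/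
def Adm (y : N.EdgeFam) (p : N.LocalFam) : Prop := ∀ i, N.NodeAdm i y (p i)

/-- There is one vector `z_{i,j} = z_{j,i}` for each undirected edge. -/
def SymFam (z : N.EdgeFam) : Prop := ∀ a : N.G.Dart, z a.symm = (z a).flip

/-- The total cost `∑ f_i(y_i, p_i)`. -/
def cost (q : N.Var) : ℝ := ∑ i, N.nodeCost i q.1 (q.2.1 i)

/-- Feasible points of the edge-based problem with copies: `y_{i,j}^i = z_{i,j} = y_{i,j}^j`. -/
def Feasible (q : N.Var) : Prop := N.Adm q.1 q.2.1 ∧ N.SymFam q.2.2 ∧ ∀ a, q.1 a - q.2.2 a = 0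

/-- Optimal solutions of the edge-based problem with copies. -/
def IsOptimal (q : N.Var) : Prop := N.Feasible q ∧ ∀ q', N.Feasible q' → N.cost q ≤ N.cost q'

/-- The regularized Lagrangian `ℒ(y, p, z, λ)`; for `ρ = 0` it is the ordinary Lagrangian. The sum
over ordered pairs of neighbours collects both copies of every undirected edge. -/
def lagr (ρ : ℝ) (q : N.Var) (lam : N.EdgeFam) : ℝ :=
  N.cost q + ∑ a, inner ℝ (lam a) (q.1 a - q.2.2 a) + ∑ a, ρ / 2 * ‖q.1 a - q.2.2 a‖ ^ 2

/-- `(q, λ)` is a primal-dual solution: `q` is optimal and `λ` is a Lagrange multiplier for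
the coupling constraints, that is, `q` minimizes the ordinary Lagrangian `ℒ₀(·, λ)`. -/
def IsSolutionPair (q : N.Var) (lam : N.EdgeFam) : Prop :=
  N.IsOptimal q ∧
  ∀ q' : N.Var, N.Adm q'.1 q'.2.1 → N.SymFam q'.2.2 → N.lagr 0 q lam ≤ N.lagr 0 q' lam

open Classical in
/-- The objective of the update of node `i`, with `z` and `λ` given. -/
def nodeObj (ρ : ℝ) (i : V) (z lam : N.EdgeFam) (y : N.EdgeFam) (p : N.LocalVec i) : ℝ :=
  N.nodeCost i y p +
    ∑ a : N.G.Dart with a.fst = i, (inner ℝ (lam a) (y a) + ρ / 2 * ‖y a - z a‖ ^ 2)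

/-- `(y_i, p_i)` minimizes the objective of the update of node `i`. -/
def IsNodeMin (ρ : ℝ) (i : V) (z lam : N.EdgeFam) (y : N.EdgeFam) (p : N.LocalVec i) : Prop :=
  N.NodeAdm i y p ∧
  ∀ (y' : N.EdgeFam) (p' : N.LocalVec i), N.NodeAdm i y' p' →
    N.nodeObj ρ i z lam y p ≤ N.nodeObj ρ i z lam y' p'

/-- The distributed ADMM algorithm, started at zero, with exact node updates. -/
structure IsRun (ρ : ℝ) (q : ℕ → N.Var) (lam : ℕ → N.EdgeFam) : Prop where
  q_zero : q 0 = 0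
  lam_zero : lam 0 = 0
  node_update : ∀ t i, N.IsNodeMin ρ i (q t).2.2 (lam t) (q (t + 1)).1 ((q (t + 1)).2.1 i)
  z_update : ∀ t a, (q (t + 1)).2.2 a = (1 / 2 : ℝ) • ((q (t + 1)).1 a + ((q (t + 1)).1 a.symm).flip)
  lam_update : ∀ t a, lam (t + 1) a = lam t a + ρ • ((q (t + 1)).1 a - (q (t + 1)).2.2 a)

/-- The minimizer `p_i` of every node update of the run is unique. (The minimizing `y_i` is always
unique, by strong convexity.) -/
def UniqueUpdates (ρ : ℝ) (q : ℕ → N.Var) (lam : ℕ → N.EdgeFam) : Prop :=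
  ∀ t i (y' : N.EdgeFam) (p' : N.LocalVec i),
    N.IsNodeMin ρ i (q t).2.2 (lam t) y' p' → p' = (q (t + 1)).2.1 i

/-- The average of the first `t + 1` iterates `q⁽¹⁾, …, q⁽ᵗ⁺¹⁾` computed by the algorithm. -/
def avg (q : ℕ → N.Var) (t : ℕ) : N.Var :=
  ((t : ℝ) + 1)⁻¹ • ∑ κ ∈ Finset.range (t + 1), q (κ + 1)

/-- The average of `q⁽⁰⁾, …, q⁽ᵗ⁾`, in which the initial guess is included. -/
def avgInit (q : ℕ → N.Var) (t : ℕ) : N.Var :=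
  ((t : ℝ) + 1)⁻¹ • ∑ κ ∈ Finset.range (t + 1), q κ

/-- `C₀ = (2ρ ‖z⁽⁰⁾ - z*‖² + ρ⁻¹ ‖λ⁽⁰⁾ - λ*‖²) / 2`, where the squared norms are sums over the
undirected edges for `z`, and over both copies of every edge for `λ`. -/
def C₀ (ρ : ℝ) (q0 qs : N.Var) (lam0 lams : N.EdgeFam) : ℝ :=
  (ρ * ∑ a, ‖q0.2.2 a - qs.2.2 a‖ ^ 2 + ρ⁻¹ * ∑ a, ‖lam0 a - lams a‖ ^ 2) / 2

end Network

end SensorNet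

end

/-! ### Convexity and closedness of the constraint sets. -/

namespace SensorNet

/-! Write the two copies on each edge as one family. The vectors `z` are symmetric under reversal of
edges, while the residuals `y - z` and, by the zero start, the multipliers are antisymmetric; the
two kinds of families are orthogonal (`AntiFam.inner_eq_zero`). The node updates together minimize a
convex function plus a proximal term, which gives a variational inequality (`IsRun.variational`).
Tested at the solution and simplified by orthogonality, it bounds the Lagrangian gap by the decrease
of `lyap`, a weighted squared distance of `(z, λ)` to the solution (`IsRun.lagr_le`). Telescoping
and Jensen's inequality give the rate; the lower bound is the minimality of the solution for the
ordinary Lagrangian.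

For convergence, `lyap` decreases, so the residuals and the steps of `z` vanish. Everything stays
bounded, the local vectors because `Y_ii` and `x_i` control them. Upper semicontinuity makes the
cost closed, so the variational inequality passes to the limit and cluster points are primal-dual
solutions (`IsRun.isSolutionPair_of_tendsto`). Relative to such a cluster point, `lyap` is monotone
and tends to `0` along a subsequence, hence tends to `0`; this fixes the limits of `z` and `y`.

The local vectors may still oscillate, but only in the anchor distances `e`. Two optimal values `u <
v` would force the density to be globally maximal on `[u, v]`, and some node update would then have
several minimizers (`IsRun.not_e_lt_e`). A single sensor has no edges and is treated apart. -/

/-- The logarithmic form of log-concavity, where both values are positive. -/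
theorem LogConcaveOn.log_le {f : ℝ → ℝ} {s : Set ℝ} (hf : LogConcaveOn s f) {x y : ℝ} (hx : x ∈ s)
    (hy : y ∈ s) (fx : 0 < f x) (fy : 0 < f y) {a b : ℝ} (ha : 0 ≤ a) (hb : 0 ≤ b)
    (hab : a + b = 1) :
    0 < f (a * x + b * y) ∧
      a * Real.log (f x) + b * Real.log (f y) ≤ Real.log (f (a * x + b * y)) := by
  have h := hf.2 x hx y hy a b ha hb hab
  have hp : 0 < f x ^ a * f y ^ b := mul_pos (Real.rpow_pos_of_pos fx a) (Real.rpow_pos_of_pos fy b)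
  refine ⟨hp.trans_le h, ?_⟩
  have := Real.log_le_log hp h
  rwa [Real.log_mul (Real.rpow_pos_of_pos fx a).ne' (Real.rpow_pos_of_pos fy b).ne',
    Real.log_rpow fx, Real.log_rpow fy] at this

/-- The quadratic form is `(x₀ + d x₁)² + (δ - d²) x₁²`, and the vector `(-d, 1)` isolates the
second term. -/
theorem posSemidef_two_iff (d δ : ℝ) :
    (!![1, d; d, δ] : Matrix (Fin 2) (Fin 2) ℝ).PosSemidef ↔ d ^ 2 ≤ δ := by
  rw [Matrix.posSemidef_iff_dotProduct_mulVec]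
  constructor
  · rintro ⟨-, h⟩
    have := h ![-d, 1]
    simp [Matrix.mulVec, dotProduct, Fin.sum_univ_two] at this
    nlinarith
  · intro h
    refine ⟨by ext i j; fin_cases i <;> fin_cases j <;> simp, fun x => ?_⟩
    simp only [Matrix.mulVec, dotProduct, Fin.sum_univ_two, Pi.star_apply, star_trivial,
      Matrix.cons_val', Matrix.cons_val_zero, Matrix.cons_val_one, Matrix.of_apply,
      Matrix.empty_val', Matrix.cons_val_fin_one]
    nlinarith [sq_nonneg (x 0 + d * x 1), mul_nonneg (sub_nonneg.2 h) (sq_nonneg (x 1))]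

theorem sq_combo_le {a b x y s t : ℝ} (ha : 0 ≤ a) (hb : 0 ≤ b) (hab : a + b = 1)
    (hx : x ^ 2 ≤ s) (hy : y ^ 2 ≤ t) : (a * x + b * y) ^ 2 ≤ a * s + b * t := by
  have h : (a * x + b * y) ^ 2 ≤ a * x ^ 2 + b * y ^ 2 := by
    obtain rfl : b = 1 - a := by linarith
    nlinarith [mul_nonneg (mul_nonneg ha hb) (sq_nonneg (x - y))]
  nlinarith [mul_le_mul_of_nonneg_left hx ha, mul_le_mul_of_nonneg_left hy hb]

theorem isClosed_posSemidef {n : Type*} [Fintype n] :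
    IsClosed {M : Matrix n n ℝ | M.PosSemidef} := by
  simp only [Matrix.posSemidef_iff_dotProduct_mulVec, Set.ofPred_and, Set.ofPred_forall]
  refine IsClosed.inter (isClosed_eq (by fun_prop) (by fun_prop)) (isClosed_iInter fun x => ?_)
  exact isClosed_le continuous_const (by fun_prop)

namespace EdgeVec

variable {D : ℕ}

theorem flipIdx_flipIdx (c : Fin 5 ⊕ (Fin D ⊕ Fin D)) : flipIdx (flipIdx c) = c := by
  rcases c with c | c | c <;> simp [flipIdx]

theorem flip_flip (v : EdgeVec D) : v.flip.flip = v := by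
  ext c; simp [flip, flipIdx_flipIdx]

theorem flip_add (v w : EdgeVec D) : (v + w).flip = v.flip + w.flip := by
  ext c; simp [flip]

theorem flip_smul (r : ℝ) (v : EdgeVec D) : (r • v).flip = r • v.flip := by
  ext c; simp [flip]

theorem flip_zero : (0 : EdgeVec D).flip = 0 := by
  ext c; simp [flip]

theorem continuous_flip : Continuous (flip : EdgeVec D → EdgeVec D) := by
  unfold flip; fun_prop

theorem inner_flip_flip (v w : EdgeVec D) : inner ℝ v.flip w.flip = inner ℝ v w := by
  simp only [PiLp.inner_apply, flip]
  exact Equiv.sum_comp (Function.Involutive.toPerm _ flipIdx_flipIdx)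
    (fun c => inner ℝ (v.ofLp c) (w.ofLp c))

/-- The Gram-type matrix in the definition of `𝒵_ij`. -/
noncomputable def gram (v : EdgeVec D) : Matrix (Fin D ⊕ Fin 2) (Fin D ⊕ Fin 2) ℝ :=
  Matrix.fromBlocks (1 : Matrix (Fin D) (Fin D) ℝ)
    (Matrix.of fun r => ![xown v r, xother v r])
    (Matrix.of fun r => ![xown v r, xother v r]).transpose
    !![Yown v, Ycross v; Ycross v, Yother v]

/-- The sign of `δ` follows from `d ^ 2 ≤ δ`. In this form convexity and closedness can be read off
condition by condition. -/
theorem memZ_iff (v : EdgeVec D) : v.MemZ ↔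
    Yown v + Yother v - 2 * Ycross v = delta v ∧ d v ^ 2 ≤ delta v ∧ 0 ≤ d v ∧
      (gram v).PosSemidef := by
  rw [MemZ, posSemidef_two_iff]
  exact ⟨fun h => ⟨h.1, h.2.2.1, h.2.2.2.1, h.2.2.2.2⟩,
    fun h => ⟨h.1, (sq_nonneg _).trans h.2.1, h.2.1, h.2.2.1, h.2.2.2⟩⟩

/-- The identity block is constant, so `gram` is affine and not linear; the weights must sum to `1`.
-/
theorem gram_combo (v w : EdgeVec D) {a b : ℝ} (hab : a + b = 1) :
    gram (a • v + b • w) = a • gram v + b • gram w := by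
  ext (i | i) (j | j)
  · simp [gram, ← add_mul, hab]
  · fin_cases j <;> simp [gram, xown, xother]
  · fin_cases i <;> simp [gram, xown, xother]
  · fin_cases i <;> fin_cases j <;> simp [gram, Yown, Yother, Ycross]

theorem continuous_gram : Continuous (gram : EdgeVec D → _) := by
  refine continuous_matrix fun i j => ?_
  rcases i with i | i <;> rcases j with j | j
  · simp only [gram, Matrix.fromBlocks_apply₁₁]; fun_prop
  · fin_cases j <;> simp [gram, xown, xother] <;> fun_prop
  · fin_cases i <;> simp [gram, xown, xother] <;> fun_prop
  · fin_cases i <;> fin_cases j <;> simp [gram, Yown, Yother, Ycross] <;> fun_prop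

theorem MemZ.combo {v w : EdgeVec D} (hv : v.MemZ) (hw : w.MemZ) {a b : ℝ} (ha : 0 ≤ a)
    (hb : 0 ≤ b) (hab : a + b = 1) : (a • v + b • w).MemZ := by
  rw [memZ_iff] at *
  obtain ⟨h1, h2, h3, h4⟩ := hv
  obtain ⟨g1, g2, g3, g4⟩ := hw
  refine ⟨?_, ?_, ?_, ?_⟩
  · simp only [Yown, Yother, Ycross, delta, PiLp.add_apply, PiLp.smul_apply, smul_eq_mul] at *
    linear_combination a * h1 + b * g1
  · exact sq_combo_le ha hb hab h2 g2
  · exact add_nonneg (mul_nonneg ha h3) (mul_nonneg hb g3)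
  · rw [gram_combo v w hab]
    exact (h4.smul ha).add (g4.smul hb)

theorem isClosed_memZ : IsClosed {v : EdgeVec D | v.MemZ} := by
  simp only [memZ_iff, Set.ofPred_and]
  refine IsClosed.inter ?_ (IsClosed.inter ?_ (IsClosed.inter ?_ ?_))
  · exact isClosed_eq (by simp only [Yown, Yother, Ycross]; fun_prop)
      (by unfold delta; fun_prop)
  · exact isClosed_le (by unfold d; fun_prop) (by unfold delta; fun_prop)
  · exact isClosed_le (by fun_prop) (by unfold d; fun_prop)
  · exact isClosed_posSemidef.preimage continuous_gram

theorem memZ_zero : (0 : EdgeVec D).MemZ := by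
  rw [memZ_iff]
  refine ⟨by simp [Yown, Yother, Ycross, delta], by simp [d, delta], by simp [d], ?_⟩
  have : gram (0 : EdgeVec D) = Matrix.diagonal (Sum.elim (fun _ => 1) (fun _ => 0)) := by
    ext (i | i) (j | j)
    · simp [gram, Matrix.diagonal_apply, Matrix.one_apply]
    · fin_cases j <;> simp [gram, xown, xother]
    · fin_cases i <;> simp [gram, xown, xother]
    · fin_cases i <;> fin_cases j <;> simp [gram, Yown, Yother, Ycross]
  rw [this, Matrix.posSemidef_diagonal_iff]
  rintro (i | i) <;> simp

end EdgeVec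

namespace Network

variable {V A : Type*} {D : ℕ} (N : Network V A D)

theorem memP_iff (i : V) (p : N.LocalVec i) : N.MemP i p ↔ ∀ k : {k // k ∈ N.anchorNbrs i},
    locY p - 2 * (∑ r, locX p r * N.anchorPos k r) + ‖N.anchorPos k‖ ^ 2 = eps p k ∧
    e p k ^ 2 ≤ eps p k ∧ 0 ≤ e p k := by
  refine forall_congr' fun k => ?_
  rw [posSemidef_two_iff]
  exact ⟨fun h => ⟨h.1, h.2.2.1, h.2.2.2⟩,
    fun h => ⟨h.1, (sq_nonneg _).trans h.2.1, h.2.1, h.2.2⟩⟩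

variable {N} in
theorem MemP.combo {i : V} {p q : N.LocalVec i} (hp : N.MemP i p) (hq : N.MemP i q) {a b : ℝ}
    (ha : 0 ≤ a) (hb : 0 ≤ b) (hab : a + b = 1) : N.MemP i (a • p + b • q) := by
  rw [memP_iff] at *
  intro k
  obtain ⟨h1, h2, h3⟩ := hp k
  obtain ⟨g1, g2, g3⟩ := hq k
  refine ⟨?_, sq_combo_le ha hb hab h2 g2, add_nonneg (mul_nonneg ha h3) (mul_nonneg hb g3)⟩
  have hs : ∑ r, locX (a • p + b • q) r * N.anchorPos k r =
      a * ∑ r, locX p r * N.anchorPos k r + b * ∑ r, locX q r * N.anchorPos k r := by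
    simp only [locX, PiLp.add_apply, PiLp.smul_apply, smul_eq_mul, Finset.mul_sum,
      ← Finset.sum_add_distrib]
    exact Finset.sum_congr rfl fun _ _ => by ring
  rw [hs]
  simp only [locY, eps, PiLp.add_apply, PiLp.smul_apply, smul_eq_mul] at *
  linear_combination a * h1 + b * g1 - ‖N.anchorPos k‖ ^ 2 * hab

theorem isClosed_memP (i : V) : IsClosed {p : N.LocalVec i | N.MemP i p} := by
  simp only [memP_iff, Set.ofPred_and, Set.ofPred_forall]
  refine isClosed_iInter fun k => IsClosed.inter ?_ (IsClosed.inter ?_ ?_)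
  · exact isClosed_eq (by simp only [locY, locX]; fun_prop) (by simp only [eps]; fun_prop)
  · exact isClosed_le (by simp only [e]; fun_prop) (by simp only [eps]; fun_prop)
  · exact isClosed_le (by fun_prop) (by simp only [e]; fun_prop)

end Network

end SensorNet

namespace SensorNet

/-! ### The proximal and Lyapunov inequalities in an inner product space. -/

section InnerProduct

variable {E : Type*} [NormedAddCommGroup E] [InnerProductSpace ℝ E]

/-- First-order optimality for a convex function plus a linear and a quadratic proximal term. -/
theorem variational_of_prox_min {c c' ρ : ℝ} {y y' z l : E}
    (h : ∀ s : ℝ, 0 < s → s ≤ 1 → c + inner ℝ l y + ρ / 2 * ‖y - z‖ ^ 2 ≤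
      ((1 - s) * c + s * c') + inner ℝ l ((1 - s) • y + s • y') +
        ρ / 2 * ‖(1 - s) • y + s • y' - z‖ ^ 2) :
    c + inner ℝ (l + ρ • (y - z)) (y - y') ≤ c' := by
  -- Moving by `s` towards `y'` changes the quadratic term by its derivative plus an error of order
  -- `s²`; divide by `s` and let `s → 0`.
  have key : ∀ s : ℝ, 0 < s → s ≤ 1 →
      c + inner ℝ (l + ρ • (y - z)) (y - y') - c' ≤ s * (ρ / 2 * ‖y - y'‖ ^ 2) := by
    intro s hs hs1
    have h1 := h s hs hs1
    have e1 : (1 - s) • y + s • y' = y - s • (y - y') := by module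
    have e2 : y - s • (y - y') - z = (y - z) - s • (y - y') := by module
    rw [e1, e2, norm_sub_sq_real (y - z), inner_sub_right, inner_smul_right, inner_smul_right, norm_smul,
      mul_pow, Real.norm_eq_abs, sq_abs] at h1
    rw [inner_add_left, inner_smul_left]
    simp only [conj_trivial]
    refine le_of_mul_le_mul_left ?_ hs
    linarith
  have hlim : Tendsto (fun s : ℝ => s * (ρ / 2 * ‖y - y'‖ ^ 2)) (𝓝[>] 0) (𝓝 0) := by
    have : Tendsto (fun s : ℝ => s * (ρ / 2 * ‖y - y'‖ ^ 2)) (𝓝 0) (𝓝 (0 * _)) :=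
      tendsto_id.mul_const _
    rw [zero_mul] at this
    exact this.mono_left nhdsWithin_le_nhds
  have := ge_of_tendsto hlim (b := c + inner ℝ (l + ρ • (y - z)) (y - y') - c') (by
    filter_upwards [Ioc_mem_nhdsGT (zero_lt_one' ℝ)] with s hs using key s hs.1 hs.2)
  linarith

/-- The decrease of the Lyapunov function in one step of the method of multipliers. -/
theorem lyapunov_step {c cs ρ : ℝ} (hρ : 0 < ρ) {y z z' zs l l' ls : E}
    (hvi : c + inner ℝ (l' + ρ • (z' - z)) (y - zs) ≤ cs) (hl : l' = l + ρ • (y - z'))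
    (h1 : inner ℝ l' (z' - zs) = 0) (h2 : inner ℝ (z' - z) (y - z') = 0) :
    c + inner ℝ ls (y - z') + ρ / 2 * ‖y - z'‖ ^ 2 - cs ≤
      (ρ * ‖z - zs‖ ^ 2 + ρ⁻¹ * ‖l - ls‖ ^ 2) / 2 - (ρ * ‖z' - zs‖ ^ 2 + ρ⁻¹ * ‖l' - ls‖ ^ 2) / 2 -
        ρ / 2 * ‖z' - z‖ ^ 2 := by
  -- After these three expansions the squares of `z' - z` and of `y - z'` cancel, and what remains
  -- is exactly `hvi`.
  have e1 : inner ℝ (l' + ρ • (z' - z)) (y - zs) =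
      inner ℝ l' (y - z') + ρ * inner ℝ (z' - z) (z' - zs) := by
    have : y - zs = (y - z') + (z' - zs) := by abel
    rw [this, inner_add_left, inner_add_right, inner_add_right, h1, inner_smul_left,
      inner_smul_left, h2]
    simp
  have e2 : ‖z - zs‖ ^ 2 = ‖z' - zs‖ ^ 2 - 2 * inner ℝ (z' - z) (z' - zs) + ‖z' - z‖ ^ 2 := by
    have : z - zs = (z' - zs) - (z' - z) := by abel
    rw [this, norm_sub_sq_real, real_inner_comm]
  have e3 : ‖l - ls‖ ^ 2 =
      ‖l' - ls‖ ^ 2 - 2 * (ρ * inner ℝ (l' - ls) (y - z')) + ρ ^ 2 * ‖y - z'‖ ^ 2 := by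
    have : l - ls = (l' - ls) - ρ • (y - z') := by rw [hl]; abel
    rw [this, norm_sub_sq_real, inner_smul_right, norm_smul, mul_pow, Real.norm_eq_abs, sq_abs]
  rw [e1] at hvi
  rw [inner_sub_left] at e3
  rw [e2, e3]
  field_simp
  nlinarith [mul_le_mul_of_nonneg_left hvi hρ.le]

end InnerProduct

/-! ### Stacked families; convexity of the cost and of the Lagrangian. -/

namespace Network

variable {V A : Type*} {D : ℕ} (N : Network V A D)

/-- A family of edge vectors as an element of the Euclidean direct sum. -/
noncomputable def stack (y : N.EdgeFam) : PiLp 2 (fun _ : N.G.Dart => EdgeVec D) := WithLp.toLp 2 y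

variable {N}

theorem stack_add (u v : N.EdgeFam) : N.stack (u + v) = N.stack u + N.stack v := rfl
theorem stack_sub (u v : N.EdgeFam) : N.stack (u - v) = N.stack u - N.stack v := rfl
theorem stack_smul (r : ℝ) (u : N.EdgeFam) : N.stack (r • u) = r • N.stack u := rfl

theorem continuous_stack : Continuous N.stack := by
  unfold stack; fun_prop

theorem adm_iff (y : N.EdgeFam) (p : N.LocalFam) : N.Adm y p ↔
    (∀ a : N.G.Dart, (y a).MemZ ∧ (y a).Yown = locY (p a.fst) ∧
      (∀ r, (y a).xown r = locX (p a.fst) r) ∧ (N.share a ≠ 0 → 0 < N.pEdge a.edge (y a).d)) ∧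
    (∀ i, N.MemP i (p i)) ∧
    ∀ i, ∀ k : {k // k ∈ N.anchorNbrs i}, 0 < N.pAnchor i k (e (p i) k) := by
  constructor
  · exact fun h => ⟨fun a => (h a.fst).1 a rfl, fun i => (h i).2.1, fun i => (h i).2.2⟩
  · refine fun h i => ⟨?_, h.2.1 i, h.2.2 i⟩
    rintro a rfl
    exact h.1 a

theorem e_nonneg {i : V} {p : N.LocalVec i} (hp : N.MemP i p) (k : {k // k ∈ N.anchorNbrs i}) :
    0 ≤ e p k := (hp k).2.2.2

variable [Fintype V]

theorem inner_stack (u v : N.EdgeFam) :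
    inner ℝ (N.stack u) (N.stack v) = ∑ a, inner ℝ (u a) (v a) := rfl

theorem norm_sq_stack (u : N.EdgeFam) : ‖N.stack u‖ ^ 2 = ∑ a, ‖u a‖ ^ 2 :=
  PiLp.norm_sq_eq_of_L2 _ _

/-- Families carry the supremum norm; this transfers bounds and limits from the Euclidean estimates.
-/
theorem norm_le_norm_stack (u : N.EdgeFam) : ‖u‖ ≤ ‖N.stack u‖ :=
  (pi_norm_le_iff_of_nonneg (norm_nonneg _)).2 fun a => PiLp.norm_apply_le (N.stack u) a

theorem lagr_eq (ρ : ℝ) (q : N.Var) (lam : N.EdgeFam) :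
    N.lagr ρ q lam = N.cost q + inner ℝ (N.stack lam) (N.stack q.1 - N.stack q.2.2) +
      ρ / 2 * ‖N.stack q.1 - N.stack q.2.2‖ ^ 2 := by
  rw [lagr, ← stack_sub, inner_stack, norm_sq_stack, Finset.mul_sum]
  rfl

theorem C₀_eq (ρ : ℝ) (q0 qs : N.Var) (lam0 lams : N.EdgeFam) :
    N.C₀ ρ q0 qs lam0 lams = (ρ * ‖N.stack q0.2.2 - N.stack qs.2.2‖ ^ 2 +
      ρ⁻¹ * ‖N.stack lam0 - N.stack lams‖ ^ 2) / 2 := by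
  rw [C₀, ← stack_sub, ← stack_sub, norm_sq_stack, norm_sq_stack]
  rfl

theorem sum_dart_fiberwise (f : N.G.Dart → ℝ) [∀ i, DecidablePred fun a : N.G.Dart => a.fst = i] :
    ∑ i, ∑ a : N.G.Dart with a.fst = i, f a = ∑ a, f a := by
  classical
  convert Finset.sum_fiberwise Finset.univ (fun a : N.G.Dart => a.fst) f

variable (N) in
theorem cost_eq (q : N.Var) : N.cost q =
    -((∑ a : N.G.Dart, N.share a * Real.log (N.pEdge a.edge (q.1 a).d)) +
      ∑ i, ∑ k : {k // k ∈ N.anchorNbrs i}, Real.log (N.pAnchor i k (e (q.2.1 i) k))) := by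
  classical
  simp only [cost, nodeCost, Finset.sum_neg_distrib, Finset.sum_add_distrib]
  rw [sum_dart_fiberwise]

variable (N) in
/-- The set of admissible points. -/
def admSet : Set N.Var := {q | N.Adm q.1 q.2.1}

/-- Log-concavity serves twice: it keeps the densities positive along segments, so that the domain
is convex, and it gives the inequality for the values. -/
theorem convexOn_cost (hlog : N.LogConcaveSensing) (hsplit : N.IsSplit) :
    ConvexOn ℝ N.admSet N.cost := by
  have edge : ∀ q ∈ N.admSet, ∀ q' ∈ N.admSet, ∀ s t : ℝ, 0 ≤ s → 0 ≤ t → s + t = 1 → ∀ a,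
      N.share a ≠ 0 → 0 < N.pEdge a.edge (s * (q.1 a).d + t * (q'.1 a).d) ∧
        s * Real.log (N.pEdge a.edge (q.1 a).d) + t * Real.log (N.pEdge a.edge (q'.1 a).d) ≤
          Real.log (N.pEdge a.edge (s * (q.1 a).d + t * (q'.1 a).d)) := by
    intro q hq q' hq' s t hs ht hst a ha
    have h1 := ((adm_iff _ _).1 hq).1 a
    have h2 := ((adm_iff _ _).1 hq').1 a
    exact (hlog.1 _ a.edge_mem).log_le h1.1.2.2.2.1 h2.1.2.2.2.1 (h1.2.2.2 ha) (h2.2.2.2 ha)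
      hs ht hst
  have anchor : ∀ q ∈ N.admSet, ∀ q' ∈ N.admSet, ∀ s t : ℝ, 0 ≤ s → 0 ≤ t → s + t = 1 →
      ∀ i, ∀ k : {k // k ∈ N.anchorNbrs i},
      0 < N.pAnchor i k (s * e (q.2.1 i) k + t * e (q'.2.1 i) k) ∧
        s * Real.log (N.pAnchor i k (e (q.2.1 i) k)) +
          t * Real.log (N.pAnchor i k (e (q'.2.1 i) k)) ≤
          Real.log (N.pAnchor i k (s * e (q.2.1 i) k + t * e (q'.2.1 i) k)) := by
    intro q hq q' hq' s t hs ht hst i k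
    have h1 := ((adm_iff _ _).1 hq).2
    have h2 := ((adm_iff _ _).1 hq').2
    exact (hlog.2 i k k.2).log_le (e_nonneg (h1.1 i) k) (e_nonneg (h2.1 i) k) (h1.2 i k) (h2.2 i k)
      hs ht hst
  refine ⟨?_, ?_⟩
  · intro q hq q' hq' s t hs ht hst
    have h1 := (adm_iff _ _).1 hq
    have h2 := (adm_iff _ _).1 hq'
    refine (adm_iff _ _).2 ⟨fun a => ⟨(h1.1 a).1.combo (h2.1 a).1 hs ht hst, ?_, fun r => ?_,
      fun ha => (edge q hq q' hq' s t hs ht hst a ha).1⟩,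
      fun i => (h1.2.1 i).combo (h2.2.1 i) hs ht hst,
      fun i k => (anchor q hq q' hq' s t hs ht hst i k).1⟩
    · exact congrArg₂ (fun u v => s * u + t * v) (h1.1 a).2.1 (h2.1 a).2.1
    · exact congrArg₂ (fun u v => s * u + t * v) ((h1.1 a).2.2.1 r) ((h2.1 a).2.2.1 r)
  · intro q hq q' hq' s t hs ht hst
    simp only [cost_eq, smul_eq_mul]
    rw [mul_neg, mul_neg, ← neg_add, neg_le_neg_iff, mul_add, mul_add, add_add_add_comm]
    refine add_le_add ?_ ?_
    · rw [Finset.mul_sum, Finset.mul_sum, ← Finset.sum_add_distrib]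
      refine Finset.sum_le_sum fun a _ => ?_
      -- At weight zero the density may vanish and its logarithm carries no information, but the
      -- term drops out.
      by_cases ha : N.share a = 0
      · simp [ha]
      · have := mul_le_mul_of_nonneg_left (edge q hq q' hq' s t hs ht hst a ha).2 (hsplit a).1
        calc _ = N.share a * (s * Real.log (N.pEdge a.edge (q.1 a).d) +
                t * Real.log (N.pEdge a.edge (q'.1 a).d)) := by ring
          _ ≤ _ := this
    · rw [Finset.mul_sum, Finset.mul_sum, ← Finset.sum_add_distrib]
      refine Finset.sum_le_sum fun i _ => ?_
      rw [Finset.mul_sum, Finset.mul_sum, ← Finset.sum_add_distrib]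
      exact Finset.sum_le_sum fun k _ => (anchor q hq q' hq' s t hs ht hst i k).2

theorem convexOn_lagr (hlog : N.LogConcaveSensing) (hsplit : N.IsSplit) {ρ : ℝ} (hρ : 0 ≤ ρ)
    (lam : N.EdgeFam) : ConvexOn ℝ N.admSet fun q => N.lagr ρ q lam := by
  have hc := (convexOn_cost hlog hsplit)
  refine ⟨hc.1, fun q hq q' hq' s t hs ht hst => ?_⟩
  have h := hc.2 hq hq' hs ht hst
  simp only [lagr_eq, smul_eq_mul] at *
  set u := N.stack q.1 - N.stack q.2.2
  set v := N.stack q'.1 - N.stack q'.2.2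
  have e1 : N.stack (s • q + t • q').1 - N.stack (s • q + t • q').2.2 = s • u + t • v := by
    change s • N.stack q.1 + t • N.stack q'.1 - (s • N.stack q.2.2 + t • N.stack q'.2.2) = _
    simp only [u, v]; module
  have e2 : ‖s • u + t • v‖ ^ 2 ≤ s * ‖u‖ ^ 2 + t * ‖v‖ ^ 2 := by
    have h1 : ‖s • u + t • v‖ ≤ s * ‖u‖ + t * ‖v‖ := by
      refine (norm_add_le _ _).trans_eq ?_
      rw [norm_smul, norm_smul, Real.norm_of_nonneg hs, Real.norm_of_nonneg ht]
    exact (pow_le_pow_left₀ (norm_nonneg _) h1 2).trans (sq_combo_le hs ht hst le_rfl le_rfl)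
  rw [e1, inner_add_right, inner_smul_right, inner_smul_right]
  nlinarith [mul_le_mul_of_nonneg_left e2 (div_nonneg hρ zero_le_two)]

end Network
end SensorNet

/-! ### Symmetric and antisymmetric families. -/

namespace SensorNet
namespace Network

variable {V A : Type*} {D : ℕ} {N : Network V A D}

variable (N) in
/-- Families whose two copies on every edge are opposite to each other. -/
def AntiFam (u : N.EdgeFam) : Prop := ∀ a : N.G.Dart, u a.symm = -(u a).flip

theorem SymFam.combo {z w : N.EdgeFam} (hz : N.SymFam z) (hw : N.SymFam w) (s t : ℝ) :
    N.SymFam (s • z + t • w) := fun a => by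
  simp only [Pi.add_apply, Pi.smul_apply, EdgeVec.flip_add, EdgeVec.flip_smul, hz a, hw a]

theorem SymFam.sub {z w : N.EdgeFam} (hz : N.SymFam z) (hw : N.SymFam w) : N.SymFam (z - w) := by
  have := hz.combo hw 1 (-1)
  rwa [one_smul, neg_one_smul, ← sub_eq_add_neg] at this

theorem symFam_zero : N.SymFam 0 := fun _ => EdgeVec.flip_zero.symm

theorem isClosed_symFam : IsClosed {z : N.EdgeFam | N.SymFam z} := by
  simp only [SymFam, Set.ofPred_forall]
  exact isClosed_iInter fun a => isClosed_eq (continuous_apply _)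
    (EdgeVec.continuous_flip.comp (continuous_apply _))

theorem AntiFam.add_smul {u v : N.EdgeFam} (hu : N.AntiFam u) (hv : N.AntiFam v) (r : ℝ) :
    N.AntiFam (u + r • v) := fun a => by
  simp only [Pi.add_apply, Pi.smul_apply, EdgeVec.flip_add, EdgeVec.flip_smul, hu a, hv a,
    smul_neg, neg_add]

theorem antiFam_zero : N.AntiFam 0 := fun _ => by
  simp [EdgeVec.flip_zero]

theorem isClosed_antiFam : IsClosed {u : N.EdgeFam | N.AntiFam u} := by
  simp only [AntiFam, Set.ofPred_forall]
  refine isClosed_iInter fun a => isClosed_eq (continuous_apply _) (Continuous.neg ?_)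
  exact EdgeVec.continuous_flip.comp (continuous_apply _)

theorem Feasible.fst_eq {q : N.Var} (h : N.Feasible q) : q.1 = q.2.2 :=
  funext fun a => sub_eq_zero.1 (h.2.2 a)

theorem symFam_smul_sum {w : ℕ → N.Var} (hw : ∀ κ, N.SymFam (w κ).2.2) (r : ℝ) (t : ℕ) :
    N.SymFam (r • ∑ κ ∈ Finset.range t, w κ).2.2 := by
  have h : ∀ t, N.SymFam (∑ κ ∈ Finset.range t, w κ).2.2 := fun t => by
    induction t with
    | zero => exact symFam_zero
    | succ t ih =>
      rw [Finset.sum_range_succ]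
      have := ih.combo (hw t) 1 1
      rwa [one_smul, one_smul] at this
  have := (h t).combo (symFam_zero (N := N)) r 0
  rwa [smul_zero, add_zero] at this

variable (N) in
/-- The point `0`, with the squared anchor distances `ε` corrected so that `𝒫_i` contains it. -/
noncomputable def zeroAdm : N.Var :=
  (0, fun _ => WithLp.toLp 2 (Sum.elim (Sum.elim (fun k => ‖N.anchorPos k‖ ^ 2) 0) 0), 0)

theorem zeroAdm_mem_admSet (hE : ∀ a : N.G.Dart, 0 < N.pEdge a.edge 0)
    (hA : ∀ i, ∀ k ∈ N.anchorNbrs i, 0 < N.pAnchor i k 0) : N.zeroAdm ∈ N.admSet := by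
  refine (adm_iff _ _).2 ⟨fun a => ⟨EdgeVec.memZ_zero, rfl, fun r => rfl, fun _ => hE a⟩,
    fun i => ?_, fun i k => hA i k k.2⟩
  rw [memP_iff]
  intro k
  refine ⟨?_, ?_, ?_⟩ <;> simp [zeroAdm, locY, locX, eps, e]

variable [Fintype V]

/-- Reversing all darts permutes the terms of the sum, and `flip` preserves inner products, so the
sum equals its own negative. -/
theorem AntiFam.inner_eq_zero {u s : N.EdgeFam} (hu : N.AntiFam u) (hs : N.SymFam s) :
    inner ℝ (N.stack u) (N.stack s) = 0 := by
  rw [inner_stack]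
  have h : ∑ a, inner ℝ (u a) (s a) = ∑ a : N.G.Dart, inner ℝ (u a.symm) (s a.symm) :=
    (Equiv.sum_comp (Function.Involutive.toPerm _ SimpleGraph.Dart.symm_involutive)
      (fun a => inner ℝ (u a) (s a))).symm
  have h2 : ∑ a : N.G.Dart, inner ℝ (u a.symm) (s a.symm) = -∑ a, inner ℝ (u a) (s a) := by
    rw [← Finset.sum_neg_distrib]
    refine Finset.sum_congr rfl fun a _ => ?_
    rw [hu a, hs a, inner_neg_left, EdgeVec.inner_flip_flip]
  linarith

/-- The nodes' problems share no variables, so separate minimality becomes minimality of one joint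
proximal objective. -/
theorem sum_nodeObj (ρ : ℝ) (z lam : N.EdgeFam) (q : N.Var) :
    ∑ i, N.nodeObj ρ i z lam q.1 (q.2.1 i) = N.cost q + inner ℝ (N.stack lam) (N.stack q.1) +
      ρ / 2 * ‖N.stack q.1 - N.stack z‖ ^ 2 := by
  classical
  have h := sum_dart_fiberwise fun a => inner ℝ (lam a) (q.1 a) + ρ / 2 * ‖q.1 a - z a‖ ^ 2
  rw [← stack_sub, norm_sq_stack, inner_stack, Finset.mul_sum, add_assoc]
  rw [Finset.sum_add_distrib (s := Finset.univ (α := N.G.Dart))] at h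
  simp only [nodeObj, cost, Finset.sum_add_distrib (s := Finset.univ (α := V)), Pi.sub_apply, ← h]

/-! ### The descent inequality along a run. -/

section Run

variable {ρ : ℝ} {q : ℕ → N.Var} {lam : ℕ → N.EdgeFam}

theorem IsRun.symFam (hrun : N.IsRun ρ q lam) (t : ℕ) : N.SymFam (q t).2.2 := by
  cases t with
  | zero => rw [hrun.q_zero]; exact symFam_zero
  | succ t =>
    intro a
    rw [hrun.z_update, hrun.z_update, EdgeVec.flip_smul, EdgeVec.flip_add, EdgeVec.flip_flip,
      SimpleGraph.Dart.symm_symm, add_comm]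

/-- Since `z` averages the two copies, the residual is half their difference. -/
theorem IsRun.antiFam_residual (hrun : N.IsRun ρ q lam) (t : ℕ) :
    N.AntiFam ((q (t + 1)).1 - (q (t + 1)).2.2) := by
  have key : ∀ a, ((q (t + 1)).1 - (q (t + 1)).2.2) a =
      (1 / 2 : ℝ) • ((q (t + 1)).1 a + (-1 : ℝ) • ((q (t + 1)).1 a.symm).flip) := fun a => by
    rw [Pi.sub_apply, hrun.z_update]; module
  intro a
  rw [key, key, EdgeVec.flip_smul, EdgeVec.flip_add, EdgeVec.flip_smul, EdgeVec.flip_flip,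
    SimpleGraph.Dart.symm_symm]
  module

theorem IsRun.lam_succ (hrun : N.IsRun ρ q lam) (t : ℕ) :
    lam (t + 1) = lam t + ρ • ((q (t + 1)).1 - (q (t + 1)).2.2) :=
  funext fun a => hrun.lam_update t a

theorem IsRun.antiFam (hrun : N.IsRun ρ q lam) (t : ℕ) : N.AntiFam (lam t) := by
  induction t with
  | zero => rw [hrun.lam_zero]; exact antiFam_zero
  | succ t ih => rw [hrun.lam_succ]; exact ih.add_smul (hrun.antiFam_residual t) ρ

theorem IsRun.mem_admSet (hrun : N.IsRun ρ q lam) (t : ℕ) : q (t + 1) ∈ N.admSet :=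
  fun i => (hrun.node_update t i).1

/-- The joint optimality condition of all node updates in one iteration. -/
theorem IsRun.variational (hrun : N.IsRun ρ q lam) (hlog : N.LogConcaveSensing)
    (hsplit : N.IsSplit) (t : ℕ) {q' : N.Var} (hq' : q' ∈ N.admSet) :
    N.cost (q (t + 1)) + inner ℝ (N.stack (lam (t + 1)) +
      ρ • (N.stack (q (t + 1)).2.2 - N.stack (q t).2.2)) (N.stack (q (t + 1)).1 - N.stack q'.1) ≤
      N.cost q' := by
  -- The proximal argument uses the old `λ` and `z`; the multiplier update rewrites its gradient
  -- with the new ones.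
  have hl : N.stack (lam (t + 1)) + ρ • (N.stack (q (t + 1)).2.2 - N.stack (q t).2.2) =
      N.stack (lam t) + ρ • (N.stack (q (t + 1)).1 - N.stack (q t).2.2) := by
    rw [hrun.lam_succ, stack_add, stack_smul, stack_sub]; module
  rw [hl]
  refine variational_of_prox_min fun s hs hs1 => ?_
  have hc := convexOn_cost hlog hsplit
  have hm := hc.1 (hrun.mem_admSet t) hq' (sub_nonneg.2 hs1) hs.le (sub_add_cancel _ _)
  have hle := hc.2 (hrun.mem_admSet t) hq' (sub_nonneg.2 hs1) hs.le (sub_add_cancel _ _)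
  have hmin := Finset.sum_le_sum fun i (_ : i ∈ Finset.univ) =>
    (hrun.node_update t i).2 _ _ (hm i)
  rw [sum_nodeObj, sum_nodeObj] at hmin
  refine hmin.trans ?_
  simp only [smul_eq_mul] at hle
  have e1 : N.stack ((1 - s) • q (t + 1) + s • q').1 =
    (1 - s) • N.stack (q (t + 1)).1 + s • N.stack q'.1 := rfl
  rw [e1]
  linarith

variable (N) in
/-- The Lyapunov function of the method, relative to the point `(qs, lams)`. -/
noncomputable def lyap (ρ : ℝ) (qs : N.Var) (lams : N.EdgeFam) (q : N.Var) (lam : N.EdgeFam) : ℝ :=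
  (ρ * ‖N.stack q.2.2 - N.stack qs.2.2‖ ^ 2 + ρ⁻¹ * ‖N.stack lam - N.stack lams‖ ^ 2) / 2

theorem lyap_nonneg (hρ : 0 < ρ) (qs : N.Var) (lams : N.EdgeFam) (q : N.Var) (lam : N.EdgeFam) :
    0 ≤ N.lyap ρ qs lams q lam := by
  unfold lyap; positivity

variable {qs : N.Var} {lams : N.EdgeFam}

theorem lagr_of_eq {q : N.Var} (h : q.1 = q.2.2) (ρ : ℝ) (lam : N.EdgeFam) :
    N.lagr ρ q lam = N.cost q := by
  rw [lagr_eq, h]; simp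

theorem IsSolutionPair.le_lagr_zero (hsol : N.IsSolutionPair qs lams) (ρ : ℝ) {q' : N.Var}
    (hq' : q' ∈ N.admSet) (hz : N.SymFam q'.2.2) : N.lagr ρ qs lams ≤ N.lagr 0 q' lams := by
  have := hsol.2 q' hq' hz
  rwa [lagr_of_eq hsol.1.1.fst_eq] at this ⊢

theorem lagr_eq_lagr_zero (ρ : ℝ) (q : N.Var) (lam : N.EdgeFam) :
    N.lagr ρ q lam = N.lagr 0 q lam + ρ / 2 * ‖N.stack q.1 - N.stack q.2.2‖ ^ 2 := by
  simp [lagr_eq]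

/-- Keeping the penalty on the left serves two ends: nonnegativity of the gap, and later the decay
of the residuals. -/
theorem IsSolutionPair.lagr_nonneg (hsol : N.IsSolutionPair qs lams) (ρ : ℝ) {q' : N.Var}
    (hq' : q' ∈ N.admSet) (hz : N.SymFam q'.2.2) :
    ρ / 2 * ‖N.stack q'.1 - N.stack q'.2.2‖ ^ 2 ≤ N.lagr ρ q' lams - N.lagr ρ qs lams := by
  have h1 := hsol.le_lagr_zero ρ hq' hz
  rw [lagr_eq_lagr_zero ρ q']
  linarith

/-- The variational inequality is tested at `qs`. Both orthogonality conditions of `lyapunov_step`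
pair an antisymmetric with a symmetric family. -/
theorem IsRun.lagr_le (hrun : N.IsRun ρ q lam) (hlog : N.LogConcaveSensing) (hsplit : N.IsSplit)
    (hρ : 0 < ρ) (hsol : N.IsSolutionPair qs lams) (t : ℕ) :
    N.lagr ρ (q (t + 1)) lams - N.lagr ρ qs lams ≤
      N.lyap ρ qs lams (q t) (lam t) - N.lyap ρ qs lams (q (t + 1)) (lam (t + 1)) -
        ρ / 2 * ‖N.stack (q (t + 1)).2.2 - N.stack (q t).2.2‖ ^ 2 := by
  have hvi := hrun.variational hlog hsplit t (q' := qs) hsol.1.1.1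
  rw [hsol.1.1.fst_eq] at hvi
  have hs := (hrun.symFam (t + 1)).sub hsol.1.1.2.1
  have hd := (hrun.symFam (t + 1)).sub (hrun.symFam t)
  have := lyapunov_step (ls := N.stack lams) hρ hvi
    (by rw [hrun.lam_succ]; rfl) ((hrun.antiFam (t + 1)).inner_eq_zero hs)
    (by rw [real_inner_comm]; exact (hrun.antiFam_residual t).inner_eq_zero hd)
  rw [lagr_of_eq hsol.1.1.fst_eq, lagr_eq]
  exact this

theorem IsRun.sum_lagr_le (hrun : N.IsRun ρ q lam) (hlog : N.LogConcaveSensing)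
    (hsplit : N.IsSplit) (hρ : 0 < ρ) (hsol : N.IsSolutionPair qs lams) (t : ℕ) :
    ∑ κ ∈ Finset.range t, (N.lagr ρ (q (κ + 1)) lams - N.lagr ρ qs lams) ≤
      N.lyap ρ qs lams (q 0) (lam 0) - N.lyap ρ qs lams (q t) (lam t) := by
  rw [← Finset.sum_range_sub' fun κ => N.lyap ρ qs lams (q κ) (lam κ)]
  refine Finset.sum_le_sum fun κ _ => (hrun.lagr_le hlog hsplit hρ hsol κ).trans ?_
  have : 0 ≤ ρ / 2 * ‖N.stack (q (κ + 1)).2.2 - N.stack (q κ).2.2‖ ^ 2 := by positivity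
  linarith

end Run

/-! ### Averages and the ergodic rate. -/

section Average

variable {w : ℕ → N.Var}

theorem smul_sum_mem_admSet (hlog : N.LogConcaveSensing) (hsplit : N.IsSplit)
    (hw : ∀ κ, w κ ∈ N.admSet) (t : ℕ) :
    ((t : ℝ) + 1)⁻¹ • ∑ κ ∈ Finset.range (t + 1), w κ ∈ N.admSet := by
  have ht : (0 : ℝ) < t + 1 := by positivity
  rw [Finset.smul_sum]
  refine (convexOn_cost hlog hsplit).1.sum_mem (fun _ _ => (inv_pos.2 ht).le) ?_ fun κ _ => hw κ
  simp [ht.ne']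

theorem lagr_smul_sum_le (hlog : N.LogConcaveSensing) (hsplit : N.IsSplit) {ρ : ℝ} (hρ : 0 < ρ)
    (hw : ∀ κ, w κ ∈ N.admSet) (lams : N.EdgeFam) (t : ℕ) {c L : ℝ}
    (hc : ∑ κ ∈ Finset.range (t + 1), (N.lagr ρ (w κ) lams - L) ≤ c) :
    N.lagr ρ (((t : ℝ) + 1)⁻¹ • ∑ κ ∈ Finset.range (t + 1), w κ) lams - L ≤ c / ((t : ℝ) + 1) := by
  have ht : (0 : ℝ) < t + 1 := by positivity
  have h := (convexOn_lagr hlog hsplit hρ.le lams).map_sum_le (t := Finset.range (t + 1))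
    (w := fun _ => ((t : ℝ) + 1)⁻¹) (p := w) (fun _ _ => (inv_pos.2 ht).le) (by simp [ht.ne'])
    fun κ _ => hw κ
  rw [← Finset.smul_sum, ← Finset.smul_sum] at h
  rw [Finset.sum_sub_distrib, Finset.sum_const, Finset.card_range, nsmul_eq_mul] at hc
  rw [le_div_iff₀ ht]
  have h2 := mul_le_mul_of_nonneg_right h ht.le
  rw [smul_eq_mul, mul_comm (_⁻¹), inv_mul_cancel_right₀ ht.ne'] at h2
  push_cast at hc
  linarith

end Average

variable {ρ : ℝ} {q : ℕ → N.Var} {lam : ℕ → N.EdgeFam} {qs : N.Var} {lams : N.EdgeFam}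

theorem IsRun.avg_rate (hrun : N.IsRun ρ q lam) (hlog : N.LogConcaveSensing) (hsplit : N.IsSplit)
    (hρ : 0 < ρ) (hsol : N.IsSolutionPair qs lams) (t : ℕ) :
    N.Adm (N.avg q t).1 (N.avg q t).2.1 ∧
      0 ≤ N.lagr ρ (N.avg q t) lams - N.lagr ρ qs lams ∧
      N.lagr ρ (N.avg q t) lams - N.lagr ρ qs lams
        ≤ N.C₀ ρ (q 0) qs (lam 0) lams / ((t : ℝ) + 1) := by
  have hadm := smul_sum_mem_admSet hlog hsplit hrun.mem_admSet t
  refine ⟨hadm, ?_, ?_⟩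
  · refine le_trans ?_ (hsol.lagr_nonneg ρ hadm
      (symFam_smul_sum (fun κ => hrun.symFam (κ + 1)) _ _))
    positivity
  · refine lagr_smul_sum_le hlog hsplit hρ hrun.mem_admSet lams t ?_
    have := hrun.sum_lagr_le hlog hsplit hρ hsol (t + 1)
    have h0 := lyap_nonneg hρ qs lams (q (t + 1)) (lam (t + 1))
    rw [C₀_eq, ← lyap]
    linarith

/-- Of the local vectors the Lagrangian sees only the anchor distances, so `ε` can be corrected
freely. -/
theorem lagr_congr {q q' : N.Var} (h1 : q.1 = q'.1) (h2 : q.2.2 = q'.2.2)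
    (he : ∀ i (k : {k // k ∈ N.anchorNbrs i}), e (q.2.1 i) k = e (q'.2.1 i) k) (ρ : ℝ)
    (lam : N.EdgeFam) : N.lagr ρ q lam = N.lagr ρ q' lam := by
  simp only [lagr_eq, cost_eq, h1, h2, he]

theorem IsRun.avgInit_rate (hrun : N.IsRun ρ q lam) (hlog : N.LogConcaveSensing)
    (hsplit : N.IsSplit) (hρ : 0 < ρ) (hsol : N.IsSolutionPair qs lams)
    (hE : ∀ a : N.G.Dart, 0 < N.pEdge a.edge 0)
    (hA : ∀ i, ∀ k ∈ N.anchorNbrs i, 0 < N.pAnchor i k 0) (t : ℕ) :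
    0 ≤ N.lagr ρ (N.avgInit q t) lams - N.lagr ρ qs lams ∧
      N.lagr ρ (N.avgInit q t) lams - N.lagr ρ qs lams
        ≤ (N.C₀ ρ (q 0) qs (lam 0) lams + (N.lagr ρ (q 0) lams - N.lagr ρ qs lams))
          / ((t : ℝ) + 1) := by
  -- The zero vector violates `𝒫_i` when an anchor is not at the origin. `zeroAdm` replaces it
  -- without changing the Lagrangian of the average.
  set w : ℕ → N.Var := fun κ => Nat.casesOn κ N.zeroAdm fun κ => q (κ + 1) with hw
  have hwadm : ∀ κ, w κ ∈ N.admSet := by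
    rintro (_ | κ)
    · exact zeroAdm_mem_admSet hE hA
    · exact hrun.mem_admSet κ
  have hsym : ∀ κ, N.SymFam (w κ).2.2 := by
    rintro (_ | κ)
    · exact symFam_zero
    · exact hrun.symFam (κ + 1)
  have hw1 : ∀ κ, (w κ).1 = (q κ).1 := by
    rintro (_ | κ)
    · rw [hrun.q_zero]; rfl
    · rfl
  have hw2 : ∀ κ, (w κ).2.2 = (q κ).2.2 := by
    rintro (_ | κ)
    · rw [hrun.q_zero]; rfl
    · rfl
  have hwe : ∀ κ i (k : {k // k ∈ N.anchorNbrs i}), e ((w κ).2.1 i) k = e ((q κ).2.1 i) k := by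
    rintro (_ | κ) i k
    · rw [hrun.q_zero]; rfl
    · rfl
  have havg : N.lagr ρ (N.avgInit q t) lams =
      N.lagr ρ (((t : ℝ) + 1)⁻¹ • ∑ κ ∈ Finset.range (t + 1), w κ) lams := by
    refine lagr_congr ?_ ?_ ?_ ρ lams
    · simp only [avgInit, Prod.smul_fst, Prod.fst_sum, hw1]
    · simp only [avgInit, Prod.smul_snd, Prod.snd_sum, hw2]
    · intro i k
      have := fun κ => hwe κ i k
      simp only [e] at this
      simp only [avgInit, e, Prod.smul_snd, Prod.snd_sum, Prod.smul_fst, Prod.fst_sum,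
        Pi.smul_apply, Finset.sum_apply, PiLp.smul_apply, WithLp.ofLp_sum, this]
  rw [havg]
  refine ⟨?_, ?_⟩
  · refine le_trans ?_ (hsol.lagr_nonneg ρ (smul_sum_mem_admSet hlog hsplit hwadm t)
      (symFam_smul_sum hsym _ _))
    positivity
  · refine lagr_smul_sum_le hlog hsplit hρ hwadm lams t ?_
    have := hrun.sum_lagr_le hlog hsplit hρ hsol t
    have h0 := lyap_nonneg hρ qs lams (q t) (lam t)
    -- The initial guess is split off and pays its own gap; the other `t` terms telescope.
    rw [Finset.sum_range_succ', C₀_eq, ← lyap, lagr_congr (hw1 0) (hw2 0) (hwe 0)]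
    change ∑ κ ∈ Finset.range t, (N.lagr ρ (q (κ + 1)) lams - N.lagr ρ qs lams) + _ ≤ _
    linarith

end Network
end SensorNet

/-! ### Closedness of the cost and cluster points. -/

namespace SensorNet

/-- Upper semicontinuity of weighted sums of logarithms along a sequence, including the positivity
of the limits of the factors. -/
theorem sum_log_of_tendsto {ι : Type*} [Fintype ι] {w : ι → ℝ} (hw : ∀ i, 0 ≤ w i)
    {f : ι → ℝ → ℝ} {s : Set ℝ} {x : ℕ → ι → ℝ} {y : ι → ℝ} {c : ℕ → ℝ} {c' : ℝ}
    (hf : ∀ i, UpperSemicontinuousOn (f i) s) (hxs : ∀ n i, x n i ∈ s) (hys : ∀ i, y i ∈ s)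
    (hfx : ∀ n i, 0 ≤ f i (x n i)) (hfx' : ∀ n i, w i ≠ 0 → 0 < f i (x n i))
    (hfy : ∀ i, 0 ≤ f i (y i))
    (hx : ∀ i, Tendsto (fun n => x n i) atTop (𝓝 (y i))) (hc : Tendsto c atTop (𝓝 c'))
    (hle : ∀ n, c n ≤ ∑ i, w i * Real.log (f i (x n i))) :
    (∀ i, w i ≠ 0 → 0 < f i (y i)) ∧ c' ≤ ∑ i, w i * Real.log (f i (y i)) := by
  -- Exponentiating turns the sum into a product of powers, which stays meaningful if a density
  -- vanishes at the limit.
  have hprod : ∀ v : ι → ℝ, (∀ i, w i ≠ 0 → 0 < v i) →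
      Real.exp (∑ i, w i * Real.log (v i)) = ∏ i, v i ^ w i := by
    intro v hv
    rw [Real.exp_sum]
    refine Finset.prod_congr rfl fun i _ => ?_
    by_cases hi : w i = 0
    · simp [hi]
    · rw [Real.rpow_def_of_pos (hv i hi), mul_comm]
  have hε : ∀ ε : ℝ, 0 < ε → Real.exp c' ≤ ∏ i, (f i (y i) + ε) ^ w i := by
    intro ε hε
    refine le_of_tendsto ((Real.continuous_exp.tendsto _).comp hc) ?_
    have hev : ∀ᶠ n in atTop, ∀ i, f i (x n i) < f i (y i) + ε := by
      refine eventually_all.2 fun i => ?_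
      have h1 := hf i (y i) (hys i) (f i (y i) + ε) (by linarith)
      exact (tendsto_nhdsWithin_iff.2 ⟨hx i, Eventually.of_forall fun n => hxs n i⟩).eventually h1
    filter_upwards [hev] with n hn
    calc Real.exp (c n) ≤ Real.exp (∑ i, w i * Real.log (f i (x n i))) := Real.exp_le_exp.2 (hle n)
      _ = ∏ i, f i (x n i) ^ w i := hprod _ (hfx' n)
      _ ≤ _ := Finset.prod_le_prod (fun i _ => Real.rpow_nonneg (hfx n i) _) fun i _ =>
        Real.rpow_le_rpow (hfx n i) (hn i).le (hw i)
  have hlim : Real.exp c' ≤ ∏ i, f i (y i) ^ w i := by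
    have ht : Tendsto (fun ε : ℝ => ∏ i, (f i (y i) + ε) ^ w i) (𝓝[>] 0)
        (𝓝 (∏ i, f i (y i) ^ w i)) := by
      refine tendsto_finsetProd _ fun i _ => ?_
      have h1 : Tendsto (fun ε : ℝ => (f i (y i) + ε) ^ w i) (𝓝 0) (𝓝 ((f i (y i) + 0) ^ w i)) :=
        (tendsto_const_nhds.add tendsto_id).rpow_const (Or.inr (hw i))
      rw [add_zero] at h1
      exact h1.mono_left nhdsWithin_le_nhds
    exact ge_of_tendsto ht (by filter_upwards [self_mem_nhdsWithin] with ε h using hε ε h)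
  -- A vanishing factor of positive weight would make the product zero, below `exp c'`.
  have hpos : ∀ i, w i ≠ 0 → 0 < f i (y i) := by
    intro i hi
    refine (hfy i).lt_of_ne' fun h0 => ?_
    have : ∏ i, f i (y i) ^ w i = 0 :=
      Finset.prod_eq_zero (Finset.mem_univ i) (by rw [h0, Real.zero_rpow hi])
    rw [this] at hlim
    exact (Real.exp_pos _).not_ge hlim
  exact ⟨hpos, Real.exp_le_exp.1 (by rwa [hprod _ hpos])⟩

theorem norm_le_of_norm_sub_sq_le {E : Type*} [SeminormedAddCommGroup E] {x c : E} {K : ℝ}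
    (h : ‖x - c‖ ^ 2 ≤ K) : ‖x‖ ≤ ‖c‖ + (K + 1) := by
  have h1 : ‖x‖ ≤ ‖x - c‖ + ‖c‖ := by simpa using norm_add_le (x - c) c
  nlinarith [sq_nonneg (‖x - c‖ - 1), norm_nonneg (x - c)]

theorem euclidean_norm_le {ι : Type*} [Fintype ι] {p : EuclideanSpace ℝ ι} {K : ℝ}
    (h : ∀ c, |p c| ≤ K) : ‖p‖ ≤ Real.sqrt (∑ _c : ι, K ^ 2) := by
  refine Real.le_sqrt_of_sq_le ?_
  rw [EuclideanSpace.norm_sq_eq]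
  exact Finset.sum_le_sum fun c _ => pow_le_pow_left₀ (norm_nonneg _) (h c) 2

namespace Network

variable {V A : Type*} {D : ℕ} {N : Network V A D}

/-- The linear constraint bounds `ε` through `Y_ii` and `x_i`, and then `e ≤ e² + 1 ≤ ε + 1` bounds
`e`; hence the `1` in `B`. -/
theorem exists_norm_le_of_memP (i : V) {C : ℝ} (hC : 0 ≤ C) : ∃ B : ℝ, ∀ p : N.LocalVec i,
    N.MemP i p → |locY p| ≤ C → (∀ r, |locX p r| ≤ C) → ‖p‖ ≤ B := by
  set B : {k // k ∈ N.anchorNbrs i} → ℝ := fun k =>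
    C + 2 * (∑ r, C * |N.anchorPos k r|) + ‖N.anchorPos k‖ ^ 2 + 1 with hB
  have hB0 : ∀ k, 0 ≤ B k := fun k => by
    have : 0 ≤ ∑ r, C * |N.anchorPos k r| := Finset.sum_nonneg fun r _ => by positivity
    simp only [hB]; positivity
  have hBs : ∀ k, B k ≤ C + ∑ k, B k := fun k =>
    (Finset.single_le_sum (fun k _ => hB0 k) (Finset.mem_univ k)).trans (by linarith)
  have hCs : C ≤ C + ∑ k, B k := by linarith [Finset.sum_nonneg fun k (_ : k ∈ Finset.univ) => hB0 k]
  refine ⟨_, fun p hp hY hX => euclidean_norm_le (K := C + ∑ k, B k) ?_⟩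
  rw [memP_iff] at hp
  have heps : ∀ k, eps p k + 1 ≤ B k := fun k => by
    have h1 : |∑ r, locX p r * N.anchorPos k r| ≤ ∑ r, C * |N.anchorPos k r| := by
      refine (Finset.abs_sum_le_sum_abs _ _).trans (Finset.sum_le_sum fun r _ => ?_)
      rw [abs_mul]
      exact mul_le_mul_of_nonneg_right (hX r) (abs_nonneg _)
    have h2 := (hp k).1
    simp only [hB]
    linarith [(abs_le.1 h1).1, (abs_le.1 hY).2]
  rintro ((k | k) | (_ | r))
  · refine le_trans ?_ (hBs k)
    change |eps p k| ≤ B k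
    rw [abs_of_nonneg ((sq_nonneg _).trans (hp k).2.1)]
    exact (le_add_of_nonneg_right zero_le_one).trans (heps k)
  · refine le_trans ?_ (hBs k)
    change |e p k| ≤ B k
    rw [abs_of_nonneg (hp k).2.2]
    have h1 := heps k
    have h2 := (hp k).2.1
    nlinarith [sq_nonneg (e p k - 1)]
  · exact hY.trans hCs
  · exact (hX r).trans hCs

variable [Fintype V]

/-- All terms are gathered into one weighted sum of logarithms. The bound on the costs keeps the
limit inside the domain of finite cost. -/
theorem cost_of_tendsto (hlog : N.LogConcaveSensing) (hsplit : N.IsSplit) (husc : N.UscSensing)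
    {w : ℕ → N.Var} {w' : N.Var} {c : ℕ → ℝ} {c' : ℝ} (hw : ∀ n, w n ∈ N.admSet)
    (hww' : Tendsto w atTop (𝓝 w')) (hc : Tendsto c atTop (𝓝 c')) (hle : ∀ n, N.cost (w n) ≤ c n) :
    w' ∈ N.admSet ∧ N.cost w' ≤ c' := by
  have hadm := fun n => (adm_iff _ _).1 (hw n)
  have hy : ∀ a, Tendsto (fun n => (w n).1 a) atTop (𝓝 (w'.1 a)) := fun a =>
    ((continuous_apply a).comp continuous_fst).continuousAt.tendsto.comp hww'
  have hp : ∀ i, Tendsto (fun n => (w n).2.1 i) atTop (𝓝 (w'.2.1 i)) := fun i =>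
    ((continuous_apply i).comp (continuous_fst.comp continuous_snd)).continuousAt.tendsto.comp hww'
  have hyc : ∀ a c, Tendsto (fun n => (w n).1 a c) atTop (𝓝 (w'.1 a c)) := fun a c =>
    ((PiLp.continuous_apply 2 _ c).tendsto _).comp (hy a)
  have hpc : ∀ i c, Tendsto (fun n => (w n).2.1 i c) atTop (𝓝 (w'.2.1 i c)) := fun i c =>
    ((PiLp.continuous_apply 2 _ c).tendsto _).comp (hp i)
  have hZ : ∀ a, (w'.1 a).MemZ := fun a =>
    EdgeVec.isClosed_memZ.mem_of_tendsto (hy a) (Eventually.of_forall fun n => ((hadm n).1 a).1)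
  have hP : ∀ i, N.MemP i (w'.2.1 i) := fun i =>
    (isClosed_memP N i).mem_of_tendsto (hp i) (Eventually.of_forall fun n => (hadm n).2.1 i)
  let ι := N.G.Dart ⊕ (Σ i, {k // k ∈ N.anchorNbrs i})
  let f : ι → ℝ → ℝ := Sum.elim (fun a => N.pEdge a.edge) fun k => N.pAnchor k.1 k.2
  let wt : ι → ℝ := Sum.elim N.share fun _ => 1
  let x : N.Var → ι → ℝ := fun q => Sum.elim (fun a => (q.1 a).d) fun k => e (q.2.1 k.1) k.2
  have hf0 : ∀ j, ∀ t ∈ Set.Ici (0 : ℝ), 0 ≤ f j t := by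
    rintro (a | k)
    · exact (hlog.1 _ a.edge_mem).1
    · exact (hlog.2 k.1 k.2 k.2.2).1
  have hcost : ∀ q : N.Var, N.cost q = -∑ j, wt j * Real.log (f j (x q j)) := fun q => by
    rw [cost_eq, Fintype.sum_sum_type, Fintype.sum_sigma]
    simp [wt, f, x]
  have hxs : ∀ q ∈ N.admSet, ∀ j, x q j ∈ Set.Ici (0 : ℝ) := by
    rintro q hq (a | k)
    · exact (((adm_iff _ _).1 hq).1 a).1.2.2.2.1
    · exact e_nonneg (((adm_iff _ _).1 hq).2.1 k.1) k.2
  have hys : ∀ j, x w' j ∈ Set.Ici (0 : ℝ) := by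
    rintro (a | k)
    · exact (hZ a).2.2.2.1
    · exact e_nonneg (hP k.1) k.2
  have key := sum_log_of_tendsto (w := wt) (f := f) (s := Set.Ici 0) (x := fun n => x (w n))
    (y := x w') (c := fun n => -c n) (c' := -c')
    (by rintro (a | k); exacts [(hsplit a).1, zero_le_one])
    (by rintro (a | k); exacts [husc.1 _ a.edge_mem, husc.2 k.1 k.2 k.2.2])
    (fun n => hxs _ (hw n)) hys (fun n j => hf0 j _ (hxs _ (hw n) j))
    (by
      rintro n (a | k) h
      exacts [((hadm n).1 a).2.2.2 h, (hadm n).2.2 k.1 k.2])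
    (fun j => hf0 j _ (hys j))
    (by rintro (a | k); exacts [hyc a _, hpc k.1 _]) hc.neg
    (fun n => by have := hle n; rw [hcost] at this; linarith)
  refine ⟨(adm_iff _ _).2 ⟨fun a => ⟨hZ a, ?_, fun r => ?_, fun h => key.1 (Sum.inl a) h⟩, hP,
    fun i k => key.1 (Sum.inr ⟨i, k⟩) one_ne_zero⟩, ?_⟩
  · exact tendsto_nhds_unique (hyc a _)
      ((hpc a.fst _).congr fun n => (((hadm n).1 a).2.1).symm)
  · exact tendsto_nhds_unique (hyc a _)
      ((hpc a.fst _).congr fun n => (((hadm n).1 a).2.2.1 r).symm)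
  · rw [hcost]; linarith [key.2]

variable {ρ : ℝ} {q : ℕ → N.Var} {lam : ℕ → N.EdgeFam} {qs : N.Var} {lams : N.EdgeFam}

/-- An antisymmetric `l` annihilates every symmetric `z`, so the inequality says that `q` minimizes
the ordinary Lagrangian, which equals the cost at feasible points. -/
theorem isSolutionPair_of_variational {q : N.Var} {l : N.EdgeFam} (hq : q ∈ N.admSet)
    (hz : N.SymFam q.2.2) (hyz : q.1 = q.2.2) (hl : N.AntiFam l)
    (h : ∀ q' ∈ N.admSet,
      N.cost q + inner ℝ (N.stack l) (N.stack q.1 - N.stack q'.1) ≤ N.cost q') :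
    N.IsSolutionPair q l := by
  have h0 : ∀ q' ∈ N.admSet, N.SymFam q'.2.2 → N.cost q ≤ N.lagr 0 q' l := by
    intro q' hq' hz'
    have h1 := h q' hq'
    rw [hyz, inner_sub_right, hl.inner_eq_zero hz] at h1
    rw [lagr_eq, inner_sub_right, hl.inner_eq_zero hz']
    linarith
  refine ⟨⟨⟨hq, hz, fun a => by rw [hyz, sub_self]⟩, fun q' hq' => ?_⟩, fun q' hq' hz' => ?_⟩
  · have := h0 q' hq'.1 hq'.2.1
    rwa [lagr_of_eq hq'.fst_eq] at this
  · rw [lagr_of_eq hyz]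
    exact h0 q' hq' hz'

theorem IsRun.sq_add_sq_le (hrun : N.IsRun ρ q lam) (hlog : N.LogConcaveSensing)
    (hsplit : N.IsSplit) (hρ : 0 < ρ) (hsol : N.IsSolutionPair qs lams) (t : ℕ) :
    ρ / 2 * ‖N.stack (q (t + 1)).1 - N.stack (q (t + 1)).2.2‖ ^ 2 +
      ρ / 2 * ‖N.stack (q (t + 1)).2.2 - N.stack (q t).2.2‖ ^ 2 ≤
      N.lyap ρ qs lams (q t) (lam t) - N.lyap ρ qs lams (q (t + 1)) (lam (t + 1)) := by
  have h1 := hrun.lagr_le hlog hsplit hρ hsol t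
  have h2 := hsol.lagr_nonneg ρ (hrun.mem_admSet t) (hrun.symFam (t + 1))
  linarith

theorem IsRun.antitone_lyap (hrun : N.IsRun ρ q lam) (hlog : N.LogConcaveSensing)
    (hsplit : N.IsSplit) (hρ : 0 < ρ) (hsol : N.IsSolutionPair qs lams) :
    Antitone fun t => N.lyap ρ qs lams (q t) (lam t) := by
  refine antitone_nat_of_succ_le fun t => ?_
  have h1 := hrun.sq_add_sq_le hlog hsplit hρ hsol t
  have h2 : 0 ≤ ρ / 2 * ‖N.stack (q (t + 1)).1 - N.stack (q (t + 1)).2.2‖ ^ 2 +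
      ρ / 2 * ‖N.stack (q (t + 1)).2.2 - N.stack (q t).2.2‖ ^ 2 := by positivity
  linarith

theorem tendsto_zero_of_mul_norm_sq_le {E : Type*} [SeminormedAddCommGroup E] {u : ℕ → E}
    {b : ℕ → ℝ} {r : ℝ} (hr : 0 < r) (hb : Tendsto b atTop (𝓝 0))
    (h : ∀ t, r * ‖u t‖ ^ 2 ≤ b t) : Tendsto u atTop (𝓝 0) := by
  have h1 : Tendsto (fun t => ‖u t‖ ^ 2) atTop (𝓝 0) := by
    refine squeeze_zero (fun t => by positivity) (g := fun t => r⁻¹ * b t) (fun t => ?_) ?_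
    · rw [inv_mul_eq_div, le_div_iff₀ hr, mul_comm]; exact h t
    · simpa using hb.const_mul r⁻¹
  have h2 := h1.sqrt
  simp only [Real.sqrt_sq (norm_nonneg _), Real.sqrt_zero] at h2
  exact tendsto_zero_iff_norm_tendsto_zero.2 h2

/-- A decreasing nonnegative sequence converges, so its decrements, which dominate both squares,
tend to zero. -/
theorem IsRun.tendsto_residuals (hrun : N.IsRun ρ q lam) (hlog : N.LogConcaveSensing)
    (hsplit : N.IsSplit) (hρ : 0 < ρ) (hsol : N.IsSolutionPair qs lams) :
    Tendsto (fun t => N.stack (q (t + 1)).1 - N.stack (q (t + 1)).2.2) atTop (𝓝 0) ∧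
      Tendsto (fun t => N.stack (q (t + 1)).2.2 - N.stack (q t).2.2) atTop (𝓝 0) := by
  have hlim := tendsto_atTop_ciInf (hrun.antitone_lyap hlog hsplit hρ hsol)
    ⟨0, by rintro _ ⟨t, rfl⟩; exact lyap_nonneg hρ _ _ _ _⟩
  have hd := hlim.sub (hlim.comp (tendsto_add_atTop_nat 1))
  rw [sub_self] at hd
  have hr : 0 < ρ / 2 := half_pos hρ
  refine ⟨tendsto_zero_of_mul_norm_sq_le hr hd fun t => ?_,
    tendsto_zero_of_mul_norm_sq_le hr hd fun t => ?_⟩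
  · refine le_trans (le_add_of_nonneg_right ?_) (hrun.sq_add_sq_le hlog hsplit hρ hsol t)
    positivity
  · refine le_trans (le_add_of_nonneg_left ?_) (hrun.sq_add_sq_le hlog hsplit hρ hsol t)
    positivity

/-- Cluster points of the run are primal-dual solutions. -/
theorem IsRun.isSolutionPair_of_tendsto (hrun : N.IsRun ρ q lam) (hlog : N.LogConcaveSensing)
    (hsplit : N.IsSplit) (husc : N.UscSensing) (hρ : 0 < ρ) (hsol : N.IsSolutionPair qs lams)
    {ns : ℕ → ℕ} (hns : Tendsto ns atTop atTop) {q' : N.Var} {l : N.EdgeFam}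
    (hq : Tendsto (fun n => q (ns n + 1)) atTop (𝓝 q'))
    (hl : Tendsto (fun n => lam (ns n + 1)) atTop (𝓝 l)) : N.IsSolutionPair q' l := by
  obtain ⟨r1, r2⟩ := hrun.tendsto_residuals hlog hsplit hρ hsol
  have hy : Tendsto (fun n => N.stack (q (ns n + 1)).1) atTop (𝓝 (N.stack q'.1)) :=
    ((continuous_stack.comp continuous_fst).tendsto _).comp hq
  have hz : Tendsto (fun n => (q (ns n + 1)).2.2) atTop (𝓝 q'.2.2) :=
    ((continuous_snd.comp continuous_snd).tendsto _).comp hq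
  have hyz : N.stack q'.1 = N.stack q'.2.2 :=
    sub_eq_zero.1 (tendsto_nhds_unique (hy.sub ((continuous_stack.tendsto _).comp hz))
      (r1.comp hns))
  -- The limit is taken in the variational inequality at a fixed `w`; the `ρ • 0` is what is left of
  -- the step of `z`.
  have hlim : ∀ w ∈ N.admSet, q' ∈ N.admSet ∧
      N.cost q' ≤ N.cost w - inner ℝ (N.stack l + ρ • 0) (N.stack q'.1 - N.stack w.1) := by
    intro w hw
    refine cost_of_tendsto hlog hsplit husc (fun n => hrun.mem_admSet (ns n)) hq
      (tendsto_const_nhds.sub ((((continuous_stack.tendsto _).comp hl).add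
        ((r2.comp hns).const_smul ρ)).inner (hy.sub_const _))) fun n => ?_
    have := hrun.variational hlog hsplit (ns n) hw
    simp only [Function.comp_apply]
    linarith
  refine isSolutionPair_of_variational (hlim qs hsol.1.1.1).1
    (isClosed_symFam.mem_of_tendsto hz (Eventually.of_forall fun n => hrun.symFam _))
    (WithLp.toLp_injective 2 hyz)
    (isClosed_antiFam.mem_of_tendsto hl (Eventually.of_forall fun n => hrun.antiFam _))
    fun w hw => ?_
  have := (hlim w hw).2
  rw [smul_zero, add_zero] at this
  linarith

end Network
end SensorNet

/-! ### Uniqueness of the local vectors and convergence of the run. -/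

namespace SensorNet
namespace Network

variable {V A : Type*} {D : ℕ} {N : Network V A D}

open Classical in
/-- Replace the anchor distance `e_{i,k}` in a local vector. -/
noncomputable def setE {i : V} (p : N.LocalVec i) (k : {k // k ∈ N.anchorNbrs i}) (x : ℝ) :
    N.LocalVec i :=
  WithLp.toLp 2 (Function.update p (Sum.inl (Sum.inr k)) x)

section SetE

variable {i : V} (p : N.LocalVec i) (k : {k // k ∈ N.anchorNbrs i}) (x : ℝ)

theorem e_setE_self : e (setE p k x) k = x := by simp [e, setE]

theorem e_setE_of_ne {j : {k // k ∈ N.anchorNbrs i}} (h : j ≠ k) : e (setE p k x) j = e p j := by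
  simp [e, setE, h]

theorem eps_setE (j : {k // k ∈ N.anchorNbrs i}) : eps (setE p k x) j = eps p j := by
  simp [eps, setE]

theorem locY_setE : locY (setE p k x) = locY p := by simp [locY, setE]

theorem locX_setE (r : Fin D) : locX (setE p k x) r = locX p r := by simp [locX, setE]

variable {p k x}

theorem NodeAdm.setE {y : N.EdgeFam} (h : N.NodeAdm i y p) (hx : 0 ≤ x) (hxe : x ^ 2 ≤ eps p k)
    (hfx : 0 < N.pAnchor i k x) : N.NodeAdm i y (setE p k x) := by
  refine ⟨fun a ha => ?_, ?_, fun j => ?_⟩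
  · simpa only [locY_setE, locX_setE] using h.1 a ha
  · have hP := (memP_iff N i p).1 h.2.1
    refine (memP_iff N i _).2 fun j => ?_
    simp only [locY_setE, locX_setE, eps_setE]
    refine ⟨(hP j).1, ?_⟩
    by_cases hj : j = k
    · subst hj; rw [e_setE_self]; exact ⟨hxe, hx⟩
    · rw [e_setE_of_ne p k x hj]; exact (hP j).2
  · by_cases hj : j = k
    · subst hj; rwa [e_setE_self]
    · rw [e_setE_of_ne p k x hj]; exact h.2.2 j

end SetE

/-- A node with an edge has `Y_ii` and `x_i` in its edge vector, so `ε` is a continuous function of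
`y`. -/
theorem eps_eq {q : N.Var} (hq : q ∈ N.admSet) (a : N.G.Dart)
    (k : {k // k ∈ N.anchorNbrs a.fst}) : eps (q.2.1 a.fst) k =
      (q.1 a).Yown - 2 * (∑ r, (q.1 a).xown r * N.anchorPos k r) + ‖N.anchorPos k‖ ^ 2 := by
  have h := (adm_iff _ _).1 hq
  simp only [(h.1 a).2.1, (h.1 a).2.2.1]
  exact (((memP_iff N _ _).1 (h.2.1 a.fst)) k).1.symm

variable [Fintype V]

theorem nodeCost_setE {i : V} (p : N.LocalVec i) (k : {k // k ∈ N.anchorNbrs i}) (x : ℝ)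
    (y : N.EdgeFam) : N.nodeCost i y (setE p k x) =
      N.nodeCost i y p + (Real.log (N.pAnchor i k (e p k)) - Real.log (N.pAnchor i k x)) := by
  have h : ∑ j : {k // k ∈ N.anchorNbrs i}, (Real.log (N.pAnchor i j (e p j)) -
      Real.log (N.pAnchor i j (e (setE p k x) j))) =
      Real.log (N.pAnchor i k (e p k)) - Real.log (N.pAnchor i k x) := by
    rw [Finset.sum_eq_single k, e_setE_self]
    · intro j _ hj
      rw [e_setE_of_ne p k x hj, sub_self]
    · simp
  rw [Finset.sum_sub_distrib] at h
  simp only [nodeCost]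
  linarith

theorem IsNodeMin.setE {ρ : ℝ} {i : V} {z lam y : N.EdgeFam} {p : N.LocalVec i}
    {k : {k // k ∈ N.anchorNbrs i}} {x : ℝ} (h : N.IsNodeMin ρ i z lam y p) (hx : 0 ≤ x)
    (hxe : x ^ 2 ≤ eps p k) (hle : N.pAnchor i k (e p k) ≤ N.pAnchor i k x) :
    N.IsNodeMin ρ i z lam y (Network.setE p k x) := by
  have hpos := h.1.2.2 k
  refine ⟨h.1.setE hx hxe (hpos.trans_le hle), fun y' p' h' => le_trans ?_ (h.2 y' p' h')⟩
  have := Real.log_le_log hpos hle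
  simp only [nodeObj, nodeCost_setE]
  linarith

/-- Each `e_{i,k}` can be varied alone within `0 ≤ x`, `x² ≤ ε`, so a larger density there would
lower the cost. -/
theorem IsOptimal.pAnchor_le {q : N.Var} (h : N.IsOptimal q) {i : V}
    {k : {k // k ∈ N.anchorNbrs i}} {x : ℝ} (hx : 0 ≤ x) (hxe : x ^ 2 ≤ eps (q.2.1 i) k) :
    N.pAnchor i k x ≤ N.pAnchor i k (e (q.2.1 i) k) := by
  classical
  have hpos : 0 < N.pAnchor i k (e (q.2.1 i) k) := (h.1.1 i).2.2 k
  by_contra! hlt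
  let q' : N.Var := (q.1, Function.update q.2.1 i (setE (q.2.1 i) k x), q.2.2)
  have hq' : N.Feasible q' := by
    refine ⟨fun j => ?_, h.1.2⟩
    by_cases hj : j = i
    · subst hj
      simpa [q'] using (h.1.1 j).setE hx hxe (hpos.trans hlt)
    · simpa [q', hj] using h.1.1 j
  have hd : N.cost q' - N.cost q =
      Real.log (N.pAnchor i k (e (q.2.1 i) k)) - Real.log (N.pAnchor i k x) := by
    rw [cost, cost, ← Finset.sum_sub_distrib, Finset.sum_eq_single i]
    · simp [q', nodeCost_setE]
    · intro j _ hj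
      simp [q', hj]
    · simp
  have := h.2 q' hq'
  have := Real.log_lt_log hpos hlt
  linarith

/-- A log-concave function with the same value at two points that is nowhere larger between `0`
and these points is nowhere larger on the half-line. -/
theorem _root_.SensorNet.LogConcaveOn.le_of_eq {f : ℝ → ℝ} (hf : LogConcaveOn (Set.Ici 0) f)
    {u v : ℝ} (hu : 0 ≤ u) (huv : u < v) (hpos : 0 < f u) (heq : f v = f u)
    (hle : ∀ x, 0 ≤ x → x ≤ v → f x ≤ f u) {x : ℝ} (hx : 0 ≤ x) : f x ≤ f u := by
  rcases le_or_gt x v with h | h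
  · exact hle x hx h
  -- Otherwise `v` lies between `u` and `x`, and log-concavity would make `f v` exceed `f u`.
  by_contra! hlt
  have hxu : 0 < x - u := by linarith
  have hb : 0 < (v - u) / (x - u) := div_pos (by linarith) hxu
  have ha : 0 ≤ (x - v) / (x - u) := div_nonneg (by linarith) hxu.le
  have hab : (x - v) / (x - u) + (v - u) / (x - u) = 1 := by field_simp; ring
  have key := (hf.log_le (x := u) (y := x) hu hx hpos (hpos.trans hlt) ha hb.le hab).2
  have hv : (x - v) / (x - u) * u + (v - u) / (x - u) * x = v := by field_simp; ring
  rw [hv, heq] at key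
  have := mul_lt_mul_of_pos_left (Real.log_lt_log hpos hlt) hb
  have h3 : (x - v) / (x - u) * Real.log (f u) + (v - u) / (x - u) * Real.log (f u) =
    Real.log (f u) := by rw [← add_mul, hab, one_mul]
  linarith

variable {ρ : ℝ} {q : ℕ → N.Var} {lam : ℕ → N.EdgeFam} {qs : N.Var} {lams : N.EdgeFam}

theorem IsRun.not_e_lt_e (hrun : N.IsRun ρ q lam) (hlog : N.LogConcaveSensing)
    (huniq : N.UniqueUpdates ρ q lam) {q' q'' : N.Var} (h' : N.IsOptimal q')
    (h'' : N.IsOptimal q'') (heq : q'.1 = q''.1)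
    (hy : Tendsto (fun t => (q (t + 1)).1) atTop (𝓝 q'.1)) (a : N.G.Dart)
    (k : {k // k ∈ N.anchorNbrs a.fst}) : ¬e (q'.2.1 a.fst) k < e (q''.2.1 a.fst) k := by
  intro hlt
  set u := e (q'.2.1 a.fst) k with hu
  set v := e (q''.2.1 a.fst) k with hv
  have hP' := (memP_iff N _ _).1 (h'.1.1 a.fst).2.1 k
  have hP'' := (memP_iff N _ _).1 (h''.1.1 a.fst).2.1 k
  rw [← hu] at hP'
  rw [← hv] at hP''
  have heps : eps (q'.2.1 a.fst) k = eps (q''.2.1 a.fst) k := by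
    rw [eps_eq h'.1.1, eps_eq h''.1.1, heq]
  have hu0 : 0 ≤ u := hP'.2.2
  have hvs : v ^ 2 ≤ eps (q'.2.1 a.fst) k := heps ▸ hP''.2.1
  have hus : u ^ 2 ≤ eps (q''.2.1 a.fst) k := heps ▸ hP'.2.1
  have hpos : 0 < N.pAnchor a.fst k u := (h'.1.1 a.fst).2.2 k
  have hfeq : N.pAnchor a.fst k v = N.pAnchor a.fst k u :=
    le_antisymm (h'.pAnchor_le hP''.2.2 hvs) (h''.pAnchor_le hu0 hus)
  have hle : ∀ x, 0 ≤ x → x ≤ v → N.pAnchor a.fst k x ≤ N.pAnchor a.fst k u := fun x hx hxv =>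
    h'.pAnchor_le hx ((pow_le_pow_left₀ hx hxv 2).trans hvs)
  have hfc := hlog.2 a.fst k k.2
  have hmax : ∀ x, 0 ≤ x → N.pAnchor a.fst k x ≤ N.pAnchor a.fst k u := fun x hx =>
    hfc.le_of_eq hu0 hlt hpos hfeq hle hx
  -- The endpoint `v` may saturate `v² ≤ ε`. An interior `m` is also a maximizer, and its strict
  -- inequality holds already at some finite iterate.
  obtain ⟨m, hum, hmv⟩ := exists_between hlt
  have hm0 : 0 ≤ m := hu0.trans hum.le
  have hfm : N.pAnchor a.fst k u ≤ N.pAnchor a.fst k m := by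
    have hvu : 0 < v - u := by linarith
    have hab : (v - m) / (v - u) + (m - u) / (v - u) = 1 := by field_simp; ring
    have hl := hfc.log_le (x := u) (y := v) hu0 hP''.2.2 hpos (hfeq ▸ hpos)
      (a := (v - m) / (v - u)) (b := (m - u) / (v - u)) (div_nonneg (by linarith) hvu.le)
      (div_nonneg (by linarith) hvu.le) hab
    have hm : (v - m) / (v - u) * u + (m - u) / (v - u) * v = m := by field_simp; ring
    rw [hm, hfeq, ← add_mul, hab, one_mul] at hl
    exact (Real.log_le_log_iff hpos hl.1).1 hl.2
  have hms : m ^ 2 < eps (q'.2.1 a.fst) k :=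
    (pow_lt_pow_left₀ hmv hm0 two_ne_zero).trans_le hvs
  have hlim : Tendsto (fun t => eps ((q (t + 1)).2.1 a.fst) k) atTop
      (𝓝 (eps (q'.2.1 a.fst) k)) := by
    rw [eps_eq h'.1.1]
    simp only [eps_eq (hrun.mem_admSet _)]
    have hc : Continuous fun y : N.EdgeFam =>
        (y a).Yown - 2 * (∑ r, (y a).xown r * N.anchorPos k r) + ‖N.anchorPos k‖ ^ 2 := by
      simp only [EdgeVec.Yown, EdgeVec.xown]; fun_prop
    exact (hc.tendsto _).comp hy
  obtain ⟨t, ht⟩ := (hlim.eventually (lt_mem_nhds hms)).exists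
  have hmin := hrun.node_update t a.fst
  have he0 := e_nonneg hmin.1.2.1 k
  -- Both `u` and `m` maximize the density globally, so either may replace the computed `e` in this
  -- update.
  have e1 := huniq t a.fst _ _ (hmin.setE (k := k) hu0
    ((pow_le_pow_left₀ hu0 hum.le 2).trans ht.le) (hmax _ he0))
  have e2 := huniq t a.fst _ _ (hmin.setE (k := k) hm0 ht.le ((hmax _ he0).trans hfm))
  have e3 := congrArg (fun p => e p k) (e1.trans e2.symm)
  simp only [e_setE_self] at e3
  exact hum.ne e3

theorem IsRun.local_eq_of_isOptimal (hrun : N.IsRun ρ q lam) (hlog : N.LogConcaveSensing)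
    (hdart : ∀ i, ∃ a : N.G.Dart, a.fst = i) (huniq : N.UniqueUpdates ρ q lam) {q' q'' : N.Var}
    (h' : N.IsOptimal q') (h'' : N.IsOptimal q'') (heq : q'.1 = q''.1)
    (hy : Tendsto (fun t => (q (t + 1)).1) atTop (𝓝 q'.1)) : q'.2.1 = q''.2.1 := by
  funext i
  obtain ⟨a, rfl⟩ := hdart i
  have g' := ((adm_iff _ _).1 h'.1.1).1 a
  have g'' := ((adm_iff _ _).1 h''.1.1).1 a
  ext ((k | k) | (_ | r))
  · change eps (q'.2.1 a.fst) k = eps (q''.2.1 a.fst) k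
    rw [eps_eq h'.1.1, eps_eq h''.1.1, heq]
  · exact le_antisymm
      (not_lt.1 (hrun.not_e_lt_e hlog huniq h'' h' heq.symm (heq ▸ hy) a k))
      (not_lt.1 (hrun.not_e_lt_e hlog huniq h' h'' heq hy a k))
  · exact (g'.2.1.symm.trans (by rw [heq])).trans g''.2.1
  · exact ((g'.2.2.1 r).symm.trans (by rw [heq])).trans (g''.2.2.1 r)

/-- The decreasing `lyap` bounds `z` and `λ`, the residual bounds `y`, and `y` bounds the local
vector of every node that has an edge. -/
theorem IsRun.exists_norm_le (hrun : N.IsRun ρ q lam) (hlog : N.LogConcaveSensing)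
    (hsplit : N.IsSplit) (hρ : 0 < ρ) (hsol : N.IsSolutionPair qs lams)
    (hdart : ∀ i, ∃ a : N.G.Dart, a.fst = i) :
    ∃ C, ∀ t, ‖(q (t + 1), lam (t + 1))‖ ≤ C := by
  set K := N.lyap ρ qs lams (q 0) (lam 0) with hK
  have hlyap : ∀ t, N.lyap ρ qs lams (q t) (lam t) ≤ K := fun t =>
    hrun.antitone_lyap hlog hsplit hρ hsol (Nat.zero_le t)
  have hz : ∀ t, ‖N.stack (q t).2.2 - N.stack qs.2.2‖ ^ 2 ≤ 2 * K / ρ := fun t => by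
    have h := hlyap t
    have h2 : 0 ≤ ρ⁻¹ * ‖N.stack (lam t) - N.stack lams‖ ^ 2 := by positivity
    rw [lyap] at h
    rw [le_div_iff₀ hρ]; linarith
  have hl : ∀ t, ‖N.stack (lam t) - N.stack lams‖ ^ 2 ≤ ρ * (2 * K) := fun t => by
    have h := hlyap t
    have h2 : 0 ≤ ρ * ‖N.stack (q t).2.2 - N.stack qs.2.2‖ ^ 2 := by positivity
    rw [lyap] at h
    rw [← inv_mul_le_iff₀ hρ]; linarith
  have hy : ∀ t, ‖N.stack (q (t + 1)).1 - N.stack (q (t + 1)).2.2‖ ^ 2 ≤ 2 * K / ρ := fun t => by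
    have h := hrun.sq_add_sq_le hlog hsplit hρ hsol t
    have h1 := hlyap t
    have h2 := lyap_nonneg hρ qs lams (q (t + 1)) (lam (t + 1))
    have h3 : 0 ≤ ρ / 2 * ‖N.stack (q (t + 1)).2.2 - N.stack (q t).2.2‖ ^ 2 := by positivity
    rw [le_div_iff₀ hρ]; linarith
  obtain ⟨Cz, hCz⟩ : ∃ C, ∀ t, ‖(q t).2.2‖ ≤ C := ⟨_, fun t =>
    (norm_le_norm_stack _).trans (norm_le_of_norm_sub_sq_le (hz t))⟩
  obtain ⟨Cl, hCl⟩ : ∃ C, ∀ t, ‖lam t‖ ≤ C := ⟨_, fun t =>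
    (norm_le_norm_stack _).trans (norm_le_of_norm_sub_sq_le (hl t))⟩
  obtain ⟨Cy, hCy⟩ : ∃ C, ∀ t, ‖(q (t + 1)).1‖ ≤ C := ⟨_, fun t =>
    (norm_le_norm_stack _).trans ((norm_le_of_norm_sub_sq_le (hy t)).trans
      (add_le_add_left (norm_le_of_norm_sub_sq_le (hz (t + 1))) _))⟩
  have hCy0 : 0 ≤ Cy := (norm_nonneg _).trans (hCy 0)
  choose B hB using fun i => exists_norm_le_of_memP (N := N) i hCy0
  have hp : ∀ t i, ‖(q (t + 1)).2.1 i‖ ≤ B i := by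
    intro t i
    obtain ⟨a, rfl⟩ := hdart i
    have hadm := (adm_iff _ _).1 (hrun.mem_admSet t)
    have hc : ∀ c, |(q (t + 1)).1 a c| ≤ Cy := fun c =>
      (PiLp.norm_apply_le _ c).trans ((norm_le_pi_norm _ a).trans (hCy t))
    refine hB a.fst _ (hadm.2.1 _) ?_ fun r => ?_
    · rw [← (hadm.1 a).2.1]; exact hc _
    · rw [← (hadm.1 a).2.2.1]; exact hc _
  have hB0 : ∀ i, 0 ≤ B i := fun i => (norm_nonneg _).trans (hp 0 i)
  refine ⟨max (max Cy (max (∑ i, B i) Cz)) Cl, fun t => ?_⟩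
  refine max_le_max (max_le_max (hCy t) (max_le_max ?_ (hCz _))) (hCl _)
  refine (pi_norm_le_iff_of_nonneg (Finset.sum_nonneg fun i _ => hB0 i)).2 fun i => ?_
  exact (hp t i).trans (Finset.single_le_sum (fun i _ => hB0 i) (Finset.mem_univ i))

theorem IsRun.exists_subseq (hrun : N.IsRun ρ q lam) (hlog : N.LogConcaveSensing)
    (hsplit : N.IsSplit) (husc : N.UscSensing) (hρ : 0 < ρ) (hsol : N.IsSolutionPair qs lams)
    (hdart : ∀ i, ∃ a : N.G.Dart, a.fst = i) {ns : ℕ → ℕ} (hns : Tendsto ns atTop atTop) :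
    ∃ (φ : ℕ → ℕ) (q' : N.Var) (l : N.EdgeFam), Tendsto φ atTop atTop ∧
      N.IsSolutionPair q' l ∧ Tendsto (fun n => q (ns (φ n) + 1)) atTop (𝓝 q') ∧
      Tendsto (fun n => lam (ns (φ n) + 1)) atTop (𝓝 l) := by
  obtain ⟨C, hC⟩ := hrun.exists_norm_le hlog hsplit hρ hsol hdart
  have : ProperSpace N.Var := inferInstance
  have : ProperSpace (N.Var × N.EdgeFam) := prod_properSpace
  obtain ⟨w, -, φ, hφ, hw⟩ := tendsto_subseq_of_bounded
    (Metric.isBounded_closedBall (x := (0 : N.Var × N.EdgeFam)) (r := C))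
    (x := fun n => (q (ns n + 1), lam (ns n + 1))) fun n => by
      rw [mem_closedBall_zero_iff]; exact hC _
  have h1 : Tendsto (fun n => q (ns (φ n) + 1)) atTop (𝓝 w.1) :=
    (continuous_fst.tendsto _).comp hw
  have h2 : Tendsto (fun n => lam (ns (φ n) + 1)) atTop (𝓝 w.2) :=
    (continuous_snd.tendsto _).comp hw
  exact ⟨φ, w.1, w.2, hφ.tendsto_atTop, hrun.isSolutionPair_of_tendsto hlog hsplit husc hρ hsol
    (hns.comp hφ.tendsto_atTop) h1 h2, h1, h2⟩

/-- Convergence of the run when every sensor has a neighbour. -/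
theorem IsRun.exists_limit (hrun : N.IsRun ρ q lam) (hlog : N.LogConcaveSensing)
    (hsplit : N.IsSplit) (husc : N.UscSensing) (hρ : 0 < ρ) (hsol : N.IsSolutionPair qs lams)
    (hdart : ∀ i, ∃ a : N.G.Dart, a.fst = i) :
    ∃ qo : N.Var, N.IsOptimal qo ∧ Tendsto (fun t => (q (t + 1)).1) atTop (𝓝 qo.1) ∧
      Tendsto (fun t => (q (t + 1)).2.2) atTop (𝓝 qo.2.2) ∧
      Tendsto (fun t => Metric.infDist (q (t + 1)) {q' | N.IsOptimal q'}) atTop (𝓝 0) ∧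
      (N.UniqueUpdates ρ q lam → Tendsto (fun t => q (t + 1)) atTop (𝓝 qo)) := by
  obtain ⟨φ, qo, lo, hφ, ho, hq, hl⟩ :=
    hrun.exists_subseq hlog hsplit husc hρ hsol hdart (ns := id) tendsto_id
  -- The Lyapunov function is re-centred at the cluster point, itself a primal-dual solution; a
  -- subsequence then suffices by monotonicity.
  have hsub : Tendsto (fun n => N.lyap ρ qo lo (q (φ n + 1)) (lam (φ n + 1))) atTop
      (𝓝 (N.lyap ρ qo lo qo lo)) := by
    have hs : Tendsto (fun n => N.stack (q (φ n + 1)).2.2) atTop (𝓝 (N.stack qo.2.2)) :=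
      ((continuous_stack.comp (continuous_snd.comp continuous_snd)).tendsto _).comp hq
    have hs2 : Tendsto (fun n => N.stack (lam (φ n + 1))) atTop (𝓝 (N.stack lo)) :=
      (continuous_stack.tendsto _).comp hl
    exact ((((hs.sub_const _).norm.pow 2).const_mul ρ).add
      (((hs2.sub_const _).norm.pow 2).const_mul ρ⁻¹)).div_const 2
  have hself : N.lyap ρ qo lo qo lo = 0 := by simp [lyap]
  rw [hself] at hsub
  have hV : Tendsto (fun t => N.lyap ρ qo lo (q t) (lam t)) atTop (𝓝 0) :=
    (tendsto_iff_tendsto_subseq_of_antitone (hrun.antitone_lyap hlog hsplit hρ ho)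
      ((tendsto_add_atTop_nat 1).comp hφ)).2 hsub
  have hzs : Tendsto (fun t => N.stack (q t).2.2 - N.stack qo.2.2) atTop (𝓝 0) :=
    tendsto_zero_of_mul_norm_sq_le (half_pos hρ) hV fun t => by
      have : 0 ≤ ρ⁻¹ * ‖N.stack (lam t) - N.stack lo‖ ^ 2 := by positivity
      rw [lyap]; linarith
  have hzs' := hzs.comp (tendsto_add_atTop_nat 1)
  have hys : Tendsto (fun t => N.stack (q (t + 1)).1 - N.stack qo.1) atTop (𝓝 0) := by
    have := (hrun.tendsto_residuals hlog hsplit hρ ho).1.add hzs'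
    rw [add_zero] at this
    refine this.congr fun t => ?_
    rw [ho.1.1.fst_eq]
    exact sub_add_sub_cancel _ _ _
  have unstack : ∀ {u : ℕ → N.EdgeFam} {v : N.EdgeFam},
      Tendsto (fun t => N.stack (u t) - N.stack v) atTop (𝓝 0) → Tendsto u atTop (𝓝 v) :=
    fun h => tendsto_iff_norm_sub_tendsto_zero.2 (squeeze_zero (fun _ => norm_nonneg _)
      (fun t => norm_le_norm_stack _) (tendsto_zero_iff_norm_tendsto_zero.1 h))
  have hy := unstack hys
  have hz := unstack hzs'
  refine ⟨qo, ho.1, hy, hz, ?_, fun huniq => ?_⟩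
  · refine tendsto_of_subseq_tendsto fun ns hns => ?_
    obtain ⟨ψ, q', l', -, h', hq', -⟩ := hrun.exists_subseq hlog hsplit husc hρ hsol hdart hns
    refine ⟨ψ, ?_⟩
    have := ((Metric.continuous_infDist_pt {q' | N.IsOptimal q'}).tendsto q').comp hq'
    rwa [Metric.infDist_zero_of_mem (s := {q' | N.IsOptimal q'}) h'.1] at this
  · refine tendsto_of_subseq_tendsto fun ns hns => ?_
    obtain ⟨ψ, q', l', hψ, h', hq', -⟩ := hrun.exists_subseq hlog hsplit husc hρ hsol hdart hns
    refine ⟨ψ, ?_⟩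
    have e1 : qo.1 = q'.1 := tendsto_nhds_unique (hy.comp (hns.comp hψ))
      ((continuous_fst.tendsto _).comp hq')
    have e3 : qo.2.2 = q'.2.2 := by rw [← ho.1.1.fst_eq, e1, h'.1.1.fst_eq]
    -- Every cluster point has the same `y` and `z`, so only the local vectors need the uniqueness
    -- of updates.
    have e2 := hrun.local_eq_of_isOptimal hlog hdart huniq ho.1 h'.1 e1 hy
    have : qo = q' := Prod.ext e1 (Prod.ext e2 e3)
    rwa [this]

/-- Without edges there is no coupling, and each update solves the whole problem. -/
theorem IsRun.isOptimal_of_isEmpty [IsEmpty N.G.Dart] (hrun : N.IsRun ρ q lam)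
    (hlog : N.LogConcaveSensing) (hsplit : N.IsSplit) (t : ℕ) : N.IsOptimal (q (t + 1)) := by
  refine (isSolutionPair_of_variational (l := 0) (hrun.mem_admSet t) (hrun.symFam _)
    (Subsingleton.elim _ _) antiFam_zero fun q' hq' => ?_).1
  have := hrun.variational hlog hsplit t hq'
  rw [Subsingleton.elim q'.1 (q (t + 1)).1, sub_self, inner_zero_right] at this ⊢
  exact this

theorem IsRun.exists_limit_of_isEmpty [IsEmpty N.G.Dart] (hrun : N.IsRun ρ q lam)
    (hlog : N.LogConcaveSensing) (hsplit : N.IsSplit) :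
    ∃ qo : N.Var, N.IsOptimal qo ∧ Tendsto (fun t => (q (t + 1)).1) atTop (𝓝 qo.1) ∧
      Tendsto (fun t => (q (t + 1)).2.2) atTop (𝓝 qo.2.2) ∧
      Tendsto (fun t => Metric.infDist (q (t + 1)) {q' | N.IsOptimal q'}) atTop (𝓝 0) ∧
      (N.UniqueUpdates ρ q lam → Tendsto (fun t => q (t + 1)) atTop (𝓝 qo)) := by
  have hopt := hrun.isOptimal_of_isEmpty hlog hsplit
  refine ⟨q 1, hopt 0, tendsto_const_nhds.congr fun t => Subsingleton.elim _ _,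
    tendsto_const_nhds.congr fun t => Subsingleton.elim _ _,
    tendsto_const_nhds.congr fun t =>
      (Metric.infDist_zero_of_mem (s := {q' | N.IsOptimal q'}) (hopt t)).symm,
    fun huniq => tendsto_const_nhds.congr fun t => ?_⟩
  refine Prod.ext (Subsingleton.elim _ _) (Prod.ext (funext fun i => ?_) (Subsingleton.elim _ _))
  -- All updates pose the same problem, so uniqueness makes the run constant from index `1` on.
  refine huniq t i (q 1).1 _ ?_
  have h := hrun.node_update 0 i
  rwa [Subsingleton.elim (q 0).2.2 (q t).2.2, Subsingleton.elim (lam 0) (lam t)] at h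

end Network
end SensorNet

theorem theorem1 {V A : Type*} [Fintype V] {D : ℕ} (N : SensorNet.Network V A D)
    (hconn : N.G.Connected) (hlog : N.LogConcaveSensing) (hsplit : N.IsSplit)
    (ρ : ℝ) (hρ : 0 < ρ)
    (q : ℕ → N.Var) (lam : ℕ → N.EdgeFam) (hrun : N.IsRun ρ q lam)
    (qs : N.Var) (lams : N.EdgeFam) (hsol : N.IsSolutionPair qs lams) :
    -- (a) the ergodic rate, for the averages of the computed iterates
    (∀ t : ℕ,
      N.Adm (N.avg q t).1 (N.avg q t).2.1 ∧
      0 ≤ N.lagr ρ (N.avg q t) lams - N.lagr ρ qs lams ∧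
      N.lagr ρ (N.avg q t) lams - N.lagr ρ qs lams
        ≤ N.C₀ ρ (q 0) qs (lam 0) lams / ((t : ℝ) + 1)) ∧
    -- (a') the same with the initial guess in the average, when its cost is finite
    ((∀ a : N.G.Dart, 0 < N.pEdge a.edge 0) → (∀ i, ∀ k ∈ N.anchorNbrs i, 0 < N.pAnchor i k 0) →
      ∀ t : ℕ,
        0 ≤ N.lagr ρ (N.avgInit q t) lams - N.lagr ρ qs lams ∧
        N.lagr ρ (N.avgInit q t) lams - N.lagr ρ qs lams
          ≤ (N.C₀ ρ (q 0) qs (lam 0) lams + (N.lagr ρ (q 0) lams - N.lagr ρ qs lams))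
            / ((t : ℝ) + 1)) ∧
    -- (b) convergence of the iterates
    (N.UscSensing →
      ∃ qo : N.Var, N.IsOptimal qo ∧
        Tendsto (fun t => ‖(q t).1 - qo.1‖) atTop (𝓝 0) ∧
        Tendsto (fun t => ‖(q t).2.2 - qo.2.2‖) atTop (𝓝 0) ∧
        Tendsto (fun t => Metric.infDist (q t) {q' | N.IsOptimal q'}) atTop (𝓝 0) ∧
        (N.UniqueUpdates ρ q lam → Tendsto (fun t => ‖q t - qo‖) atTop (𝓝 0))) := by
  refine ⟨hrun.avg_rate hlog hsplit hρ hsol, hrun.avgInit_rate hlog hsplit hρ hsol,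
    fun husc => ?_⟩
  have hlim : ∃ qo : N.Var, N.IsOptimal qo ∧ Tendsto (fun t => (q (t + 1)).1) atTop (𝓝 qo.1) ∧
      Tendsto (fun t => (q (t + 1)).2.2) atTop (𝓝 qo.2.2) ∧
      Tendsto (fun t => Metric.infDist (q (t + 1)) {q' | N.IsOptimal q'}) atTop (𝓝 0) ∧
      (N.UniqueUpdates ρ q lam → Tendsto (fun t => q (t + 1)) atTop (𝓝 qo)) := by
    -- Connectedness gives every sensor an edge as soon as there are two sensors.
    rcases subsingleton_or_nontrivial V with hV | hV
    · have : IsEmpty N.G.Dart := ⟨fun a => a.adj.ne (Subsingleton.elim _ _)⟩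
      exact hrun.exists_limit_of_isEmpty hlog hsplit
    · refine hrun.exists_limit hlog hsplit husc hρ hsol fun i => ?_
      obtain ⟨j, hj⟩ := hconn.preconnected.exists_adj_of_nontrivial i
      exact ⟨⟨(i, j), hj⟩, rfl⟩
  obtain ⟨qo, ho, hy, hz, hd, hu⟩ := hlim
  refine ⟨qo, ho, ?_, ?_, (tendsto_add_atTop_iff_nat 1).1 hd, fun huniq => ?_⟩
  · exact tendsto_iff_norm_sub_tendsto_zero.1
      ((tendsto_add_atTop_iff_nat (f := fun t => (q t).1) 1).1 hy)
  · exact tendsto_iff_norm_sub_tendsto_zero.1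
      ((tendsto_add_atTop_iff_nat (f := fun t => (q t).2.2) 1).1 hz)
  · exact tendsto_iff_norm_sub_tendsto_zero.1
      ((tendsto_add_atTop_iff_nat (f := q) 1).1 (hu huniq))
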